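/- Let $n\ge 1$ and let $w_1,\dots,w_n$ be positive integers. Put $w_0=1$ and $\mu=1+w_1+\cdots+w_n$. Let $U=(\mathbb C^*)^n$ with coordinates $u_1,\dots,u_n$, and $$F(u,x)=u_1+\cdots+u_n+\frac{x}{u_1^{w_1}\cdots u_n^{w_n}},\qquad x\in\mathbb C^*.$$ With $\theta=\tau^{-1}$ and $d_u$ the differential with respect to $u$ only, let $$G=\frac{\Omega^n(U)[\tau,\tau^{-1},x,x^{-1}]}{(d_u-\tau\, d_uF)\wedge\Omega^{n-1}(U)[\tau,\tau^{-1},x,x^{-1}]},\qquad G_0=\frac{\Omega^n(U)[\theta,x,x^{-1}]}{(\theta d_u-d_uF)\wedge\Omega^{n-1}(U)[\theta,x,x^{-1}]}$$ be the Gauss-Manin system and the Brieskorn lattice of $F$ (algebraic forms), with the natural map $G_0\to G$. The connection $\nabla$ on $G$ is induced by $\nabla_{\partial_\tau}(\eta)=\partial\eta/\partial\tau-F\eta$ and $\nabla_{\partial_x}(\eta)=\partial\eta/\partial x-\tau\frac{\partial F}{\partial x}\eta$, and $\nabla_{\partial_\theta}=-\tau^2\nabla_{\partial_\tau}$. Let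 $s_0\le s_1\le\cdots\le s_{\mu-1}$ be the elements, counted with multiplicity, of the disjoint union of the sets $\{\ell\mu/w_i \mid \ell=0,\dots,w_i-1\}$, $i=0,\dots,n$, and put $\alpha_k=k-s_k$. Define $a(k)\in\mathbb N^{n+1}$ by $a(0)=0$ and $a(k+1)=a(k)+\mathbf 1_{i(k)}$, where $i(k)$ is the smallest index $i\in\{0,\dots,n\}$ at which $a(k)_i/w_i$ is minimal. Put $u_0=1/(u_1^{w_1}\cdots u_n^{w_n})$ and, for $k=0,\dots,\mu-1$, $$\omega_k=\Big(\prod_{i=1}^n w_i^{-a(k)_i}\Big)\,u_0^{a(k)_0}u_1^{a(k)_1}\cdots u_n^{a(k)_n}\ \frac{du_1}{u_1}\wedge\cdots\wedge\frac{du_n}{u_n}.$$ Then: (1) $G_0$ is a free $\mathbb C[x,x^{-1},\theta]$-module of rank $\mu$, and the classes of $\omega=(\omega_0,\dots,\omega_{\mu-1})$ form a basis of it; their images form a basis of $G$ over $\mathbb C[x,x^{-1},\tau,\tau^{-1}]$. (2) In the basis $\omega$, the matrix of $\nabla$ (acting by $\nabla\omega_k=\sum_j M_{jk}\,\omega_j$,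 with rows and columns numbered from $0$ to $\mu-1$) is $$\Big(\frac{A_0(x)}{\theta}+A_\infty\Big)\frac{d\theta}{\theta}+\Big(R-\frac{A_0(x)}{\mu\theta}\Big)\frac{dx}{x},$$ where $A_\infty=\mathrm{diag}(\alpha_0,\dots,\alpha_{\mu-1})$, $R=\mathrm{diag}(0,-1,\dots,-1,-s_{\mu-1}/\mu,\dots,-s_{n+1}/\mu)$ (with $n$ entries $-1$), and $A_0(x)$ is the $\mu\times\mu$ matrix whose only nonzero entries are $(A_0)_{1,0}=\mu x$, $(A_0)_{k+1,k}=\mu$ for $1\le k\le\mu-2$, and $(A_0)_{0,\mu-1}=\mu/(w_1^{w_1}\cdots w_n^{w_n})$. -/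

import Mathlib

namespace Brieskorn

noncomputable section

/-! ### Coefficient rings and differential operators -/

/-- `ℂ[x, x⁻¹]`; the variable `x` is `LaurentPolynomial.T 1`. -/
abbrev Lx : Type := LaurentPolynomial ℂ

/-- `ℂ[x, x⁻¹, θ]`; the variable `θ` is `Polynomial.X`. -/
abbrev LxTheta : Type := Polynomial Lx

/-- `ℂ[x, x⁻¹, τ, τ⁻¹]`; the variable `τ` is `LaurentPolynomial.T 1`. -/
abbrev LxTau : Type := LaurentPolynomial Lx

/-- `K[u₁, u₁⁻¹, …, uₙ, uₙ⁻¹]`, the functions on the torus `U = (ℂ^*)ⁿ` with coefficients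
extended to `K`. The monomial `u₁^{m₁} ⋯ uₙ^{mₙ}` is `AddMonoidAlgebra.single m 1`. -/
abbrev Fn (K : Type) [CommRing K] (n : ℕ) : Type := AddMonoidAlgebra K (Fin n → ℤ)

/-- For an additive map `φ : M → ℤ`, the `K`-derivation `t^m ↦ φ(m) t^m` of `K[M]`. -/
def eulerDer (K : Type) [CommRing K] {M : Type} [AddCommMonoid M] (φ : M →+ ℤ) :
    Derivation K (AddMonoidAlgebra K M) (AddMonoidAlgebra K M) :=
  Derivation.mk'
    { toFun := fun g => g.coeff.sum fun m r => AddMonoidAlgebra.single m ((φ m : K) * r)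
      map_add' := fun f g => by
        rw [AddMonoidAlgebra.coeff_add, Finsupp.sum_add_index']
        · intro m; simp
        · intro m a b; rw [mul_add, AddMonoidAlgebra.single_add]
      map_smul' := fun c g => by
        rw [AddMonoidAlgebra.coeff_smul, Finsupp.sum_smul_index' (by intro m; simp),
          RingHom.id_apply, Finsupp.smul_sum]
        refine Finsupp.sum_congr fun m _ => ?_
        rw [AddMonoidAlgebra.smul_single, smul_eq_mul, smul_eq_mul, mul_left_comm] }
    (by
      intro a b
      induction a using AddMonoidAlgebra.induction_linear with
      | zero => simp
      | add f g hf hg => rw [add_mul, map_add, hf, hg, map_add, add_smul, smul_add]; abel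
      | single m r =>
        induction b using AddMonoidAlgebra.induction_linear with
        | zero => simp
        | add f g hf hg => rw [mul_add, map_add, hf, hg, map_add, add_smul, smul_add]; abel
        | single k s =>
          simp only [AddMonoidAlgebra.single_mul_single, LinearMap.coe_mk, AddHom.coe_mk,
            AddMonoidAlgebra.coeff_single, smul_eq_mul]
          rw [Finsupp.sum_single_index (by simp), Finsupp.sum_single_index (by simp),
            Finsupp.sum_single_index (by simp), AddMonoidAlgebra.single_mul_single,
            AddMonoidAlgebra.single_mul_single, add_comm k m, ← AddMonoidAlgebra.single_add]
          congr 1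
          push_cast [map_add]
          ring)

theorem eulerDer_single (K : Type) [CommRing K] {M : Type} [AddCommMonoid M] (φ : M →+ ℤ)
    (m : M) (r : K) :
    eulerDer K φ (AddMonoidAlgebra.single m r) = AddMonoidAlgebra.single m ((φ m : K) * r) := by
  change (AddMonoidAlgebra.coeff (AddMonoidAlgebra.single m r)).sum
    (fun m r => AddMonoidAlgebra.single m ((φ m : K) * r)) = _
  rw [AddMonoidAlgebra.coeff_single, Finsupp.sum_single_index (by simp)]

/-- The derivation of `K[M]` which applies a derivation `δ` of `K` to each coefficient. -/
def coeffDer {K : Type} [CommRing K] [Algebra ℂ K] (M : Type) [AddCommMonoid M]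
    (δ : Derivation ℂ K K) :
    Derivation ℂ (AddMonoidAlgebra K M) (AddMonoidAlgebra K M) :=
  Derivation.mk'
    { toFun := fun g => AddMonoidAlgebra.map (δ : K →+ K) g
      map_add' := fun f g => by ext m; simp
      map_smul' := fun c g => by ext m; simp }
    (by
      intro a b
      induction a using AddMonoidAlgebra.induction_linear with
      | zero => simp
      | add f g hf hg => rw [add_mul, map_add, hf, hg, map_add, add_smul, smul_add]; abel
      | single m r =>
        induction b using AddMonoidAlgebra.induction_linear with
        | zero => simp
        | add f g hf hg => rw [mul_add, map_add, hf, hg, map_add, add_smul, smul_add]; abel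
        | single k s =>
          simp only [AddMonoidAlgebra.single_mul_single, LinearMap.coe_mk, AddHom.coe_mk,
            AddMonoidAlgebra.map_single, smul_eq_mul, AddMonoidHom.coe_coe, Derivation.leibniz]
          rw [add_comm k m, ← AddMonoidAlgebra.single_add])

theorem coeffDer_single {K : Type} [CommRing K] [Algebra ℂ K] {M : Type} [AddCommMonoid M]
    (δ : Derivation ℂ K K) (m : M) (r : K) :
    coeffDer M δ (AddMonoidAlgebra.single m r) = AddMonoidAlgebra.single m (δ r) := by
  change AddMonoidAlgebra.map _ _ = _
  rw [AddMonoidAlgebra.map_single]; rfl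

/-- `∂/∂t` on `K[t, t⁻¹]`. -/
def laurentDeriv (K : Type) [CommRing K] :
    Derivation K (LaurentPolynomial K) (LaurentPolynomial K) :=
  (LaurentPolynomial.T (-1) : LaurentPolynomial K) • eulerDer K (AddMonoidHom.id ℤ)

/-- `∂/∂τ` on `ℂ[x, x⁻¹, τ, τ⁻¹]`. -/
def dTau : Derivation ℂ LxTau LxTau := (laurentDeriv Lx).restrictScalars ℂ

/-- `∂/∂x` on `ℂ[x, x⁻¹, τ, τ⁻¹]`. -/
def dX : Derivation ℂ LxTau LxTau := coeffDer ℤ (laurentDeriv ℂ)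

/-- The logarithmic derivation `uᵢ ∂/∂uᵢ` of `K[u, u⁻¹]`. -/
def dLog (K : Type) [CommRing K] {n : ℕ} (i : Fin n) : Derivation K (Fn K n) (Fn K n) :=
  eulerDer K (Pi.evalAddMonoidHom (fun _ : Fin n => ℤ) i)

/-! ### Algebraic differential forms on the torus -/

/-- Algebraic `q`-forms on the torus `U = (ℂ^*)ⁿ`, relative to `K`, in coordinates: the module is
free over the functions on the frame `du_{i₁}/u_{i₁} ∧ ⋯ ∧ du_{i_q}/u_{i_q}`, `i₁ < ⋯ < i_q`, and
the form `η` is recorded by its coefficient `η S` for each `S = {i₁ < ⋯ < i_q}`. For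
`K = LxTheta` this is `Ω^q(U)[θ, x, x⁻¹]`, for `K = LxTau` it is `Ω^q(U)[τ, τ⁻¹, x, x⁻¹]`. -/
abbrev Form (K : Type) [CommRing K] (n q : ℕ) : Type :=
  {S : Finset (Fin n) // S.card = q} → Fn K n

/-- The operator `∑ᵢ duᵢ/uᵢ ∧ Tᵢ` from `(q-1)`-forms to `q`-forms, where the operator `Tᵢ` acts on
the coefficients: the coefficient of `duᵢ/uᵢ ∧ e_{S∖i}` on `e_S` is `(-1)^#{j ∈ S, j < i}`.
(For `q = 0` it is `0`, as it has to be.) -/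
def frameWedge {K : Type} [CommRing K] {n : ℕ} (q : ℕ) (T : Fin n → Fn K n →ₗ[K] Fn K n) :
    Form K n (q - 1) →ₗ[K] Form K n q :=
  LinearMap.pi fun S => ∑ i : {i // i ∈ S.1},
    (-1 : K) ^ (S.1.filter fun j => j < i.1).card •
      (T i.1 ∘ₗ LinearMap.proj
        ⟨S.1.erase i.1, by rw [Finset.card_erase_of_mem i.2, S.2]⟩)

/-- The exterior differential `d_u` (with respect to `u` only). -/
def extD (K : Type) [CommRing K] (n q : ℕ) : Form K n (q - 1) →ₗ[K] Form K n q :=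
  frameWedge q fun i => (dLog K i : Fn K n →ₗ[K] Fn K n)

/-- `η ↦ d_u g ∧ η`, where `d_u g = ∑ᵢ uᵢ ∂g/∂uᵢ · duᵢ/uᵢ`. -/
def dWedge {K : Type} [CommRing K] {n : ℕ} (q : ℕ) (g : Fn K n) :
    Form K n (q - 1) →ₗ[K] Form K n q :=
  frameWedge q fun i => LinearMap.mulLeft K (dLog K i g)

/-- The top form `g · du₁/u₁ ∧ ⋯ ∧ duₙ/uₙ`. -/
def topForm {K : Type} [CommRing K] {n : ℕ} (g : Fn K n) : Form K n n := fun _ => g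

/-! ### The Gauss-Manin system and the Brieskorn lattice -/

/-- `F = u₁ + ⋯ + uₙ + x / (u₁^{w₁} ⋯ uₙ^{wₙ})`. -/
def potential (K : Type) [CommRing K] [Algebra Lx K] {n : ℕ} (w : Fin n → ℕ) : Fn K n :=
  ∑ i, AddMonoidAlgebra.single (Pi.single i (1 : ℤ)) 1 +
    AddMonoidAlgebra.single (fun i => -(w i : ℤ)) (algebraMap Lx K (LaurentPolynomial.T 1))

/-- `(θ d_u - d_u F) ∧ Ω^{n-1}(U)[θ, x, x⁻¹]`. -/
def latticeRel {n : ℕ} (w : Fin n → ℕ) : Submodule LxTheta (Form LxTheta n n) :=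
  LinearMap.range
    ((Polynomial.X : LxTheta) • extD LxTheta n n - dWedge n (potential LxTheta w))

/-- The Brieskorn lattice `G₀` of `F`. -/
abbrev G0 {n : ℕ} (w : Fin n → ℕ) : Type := Form LxTheta n n ⧸ latticeRel w

/-- `(d_u - τ d_u F) ∧ Ω^{n-1}(U)[τ, τ⁻¹, x, x⁻¹]`. -/
def systemRel {n : ℕ} (w : Fin n → ℕ) : Submodule LxTau (Form LxTau n n) :=
  LinearMap.range
    (extD LxTau n n - (LaurentPolynomial.T 1 : LxTau) • dWedge n (potential LxTau w))

/-- The Gauss-Manin system `G` of `F`. -/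
abbrev G {n : ℕ} (w : Fin n → ℕ) : Type := Form LxTau n n ⧸ systemRel w

/-! ### The natural map `G₀ → G` -/

/-- The inclusion `ℂ[x, x⁻¹, θ] → ℂ[x, x⁻¹, τ, τ⁻¹]`, `θ ↦ τ⁻¹`. -/
def thetaIncl : LxTheta →+* LxTau :=
  Polynomial.eval₂RingHom LaurentPolynomial.C (LaurentPolynomial.T (-1))

/-- Change of coefficients on functions. -/
def fnMap (n : ℕ) : Fn LxTheta n →+* Fn LxTau n :=
  AddMonoidAlgebra.mapRingHom (Fin n → ℤ) thetaIncl

theorem fnMap_single {n : ℕ} (m : Fin n → ℤ) (r : LxTheta) :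
    fnMap n (AddMonoidAlgebra.single m r) = AddMonoidAlgebra.single m (thetaIncl r) := by
  simp [fnMap]

theorem fnMap_smul {n : ℕ} (c : LxTheta) (g : Fn LxTheta n) :
    fnMap n (c • g) = thetaIncl c • fnMap n g := by
  ext m
  simp [fnMap]

/-- Change of coefficients on forms, `Ω^q(U)[θ, x, x⁻¹] → Ω^q(U)[τ, τ⁻¹, x, x⁻¹]`. -/
def formMap (n q : ℕ) : Form LxTheta n q →ₛₗ[thetaIncl] Form LxTau n q where
  toFun η := fun S => fnMap n (η S)
  map_add' η ξ := by ext1 S; exact map_add _ _ _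
  map_smul' c η := by ext1 S; exact fnMap_smul _ _

theorem fnMap_dLog {n : ℕ} (i : Fin n) (g : Fn LxTheta n) :
    fnMap n (dLog LxTheta i g) = dLog LxTau i (fnMap n g) := by
  induction g using AddMonoidAlgebra.induction_linear with
  | zero => simp
  | add f g hf hg => simp only [map_add, hf, hg]
  | single m r =>
    rw [dLog, dLog, eulerDer_single, fnMap_single, fnMap_single, eulerDer_single, map_mul,
      map_intCast]

theorem fnMap_potential {n : ℕ} (w : Fin n → ℕ) :
    fnMap n (potential LxTheta w) = potential LxTau w := by
  simp only [potential, map_add, map_sum, fnMap_single, map_one]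
  congr 2
  simp only [Polynomial.algebraMap_eq, thetaIncl, Polynomial.coe_eval₂RingHom, Polynomial.eval₂_C]
  rfl

theorem formMap_frameWedge {n q : ℕ} (T : Fin n → Fn LxTheta n →ₗ[LxTheta] Fn LxTheta n)
    (T' : Fin n → Fn LxTau n →ₗ[LxTau] Fn LxTau n)
    (h : ∀ i g, fnMap n (T i g) = T' i (fnMap n g)) (η : Form LxTheta n (q - 1)) :
    formMap n q (frameWedge q T η) = frameWedge q T' (formMap n (q - 1) η) := by
  ext1 S
  change fnMap n (frameWedge q T η S) = _
  simp only [frameWedge, LinearMap.pi_apply, LinearMap.sum_apply, LinearMap.smul_apply,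
    LinearMap.comp_apply, LinearMap.proj_apply, map_sum, fnMap_smul, h, map_pow, map_neg, map_one]
  rfl

theorem thetaIncl_X : thetaIncl Polynomial.X = LaurentPolynomial.T (-1) := by
  simp [thetaIncl]

theorem latticeRel_le {n : ℕ} (w : Fin n → ℕ) :
    latticeRel w ≤ (systemRel w).comap (formMap n n) := by
  rintro _ ⟨η, rfl⟩
  refine ⟨(LaurentPolynomial.T (-1) : LxTau) • formMap n (n - 1) η, ?_⟩
  have h1 : formMap n n (extD LxTheta n n η) = extD LxTau n n (formMap n (n - 1) η) :=
    formMap_frameWedge _ _ (fun i g => fnMap_dLog i g) η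
  have h2 : formMap n n (dWedge n (potential LxTheta w) η) =
      dWedge n (potential LxTau w) (formMap n (n - 1) η) := by
    refine formMap_frameWedge _ _ (fun i g => ?_) η
    rw [LinearMap.mulLeft_apply, LinearMap.mulLeft_apply, map_mul, fnMap_dLog, fnMap_potential]
  rw [map_smul, LinearMap.sub_apply, LinearMap.smul_apply, LinearMap.sub_apply,
    LinearMap.smul_apply, map_sub, LinearMap.map_smulₛₗ, h1, h2, thetaIncl_X, smul_sub, smul_smul,
    ← LaurentPolynomial.T_add]
  simp

/-- The natural map `G₀ → G`. -/
def toG {n : ℕ} (w : Fin n → ℕ) : G0 w →ₛₗ[thetaIncl] G w :=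
  Submodule.mapQ (latticeRel w) (systemRel w) (formMap n n) (latticeRel_le w)

/-! ### The connection -/

/-- The operator `η ↦ δ η - f η` on forms, where `δ` acts on the coefficients of the monomials in
`u₁, …, uₙ`. -/
def connOp {K : Type} [CommRing K] [Algebra ℂ K] {n : ℕ} (q : ℕ) (δ : Derivation ℂ K K)
    (f : Fn K n) : Form K n q →ₗ[ℂ] Form K n q :=
  LinearMap.pi fun S =>
    ((coeffDer (Fin n → ℤ) δ : Fn K n →ₗ[ℂ] Fn K n) - LinearMap.mulLeft ℂ f) ∘ₗ
      LinearMap.proj S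

section

variable {K : Type} [CommRing K] [Algebra ℂ K] {n : ℕ}

theorem connOp_apply {q : ℕ} (δ : Derivation ℂ K K) (f : Fn K n)
    (η : Form K n q) (S : {S : Finset (Fin n) // S.card = q}) :
    connOp q δ f η S = coeffDer (Fin n → ℤ) δ (η S) - f * η S := rfl

theorem coeffDer_dLog (δ : Derivation ℂ K K) (i : Fin n) (g : Fn K n) :
    coeffDer (Fin n → ℤ) δ (dLog K i g) = dLog K i (coeffDer (Fin n → ℤ) δ g) := by
  induction g using AddMonoidAlgebra.induction_linear with
  | zero => simp
  | add f g hf hg => simp only [map_add, hf, hg]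
  | single m r =>
    rw [dLog, eulerDer_single, coeffDer_single, coeffDer_single, eulerDer_single]
    simp

theorem coeffDer_smul (δ : Derivation ℂ K K) (c : K) (g : Fn K n) :
    coeffDer (Fin n → ℤ) δ (c • g) = δ c • g + c • coeffDer (Fin n → ℤ) δ g := by
  induction g using AddMonoidAlgebra.induction_linear with
  | zero => simp
  | add f g hf hg => simp only [map_add, smul_add, hf, hg]; abel
  | single m r =>
    simp only [coeffDer_single, AddMonoidAlgebra.smul_single, smul_eq_mul, Derivation.leibniz]
    rw [← AddMonoidAlgebra.single_add]
    congr 1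
    ring

/-- The condition `δ(t uᵢ∂g/∂uᵢ) = uᵢ∂f/∂uᵢ` makes `η ↦ δ η - f η` commute with
`d_u - t d_u g ∧`. -/
theorem connOp_comm (δ : Derivation ℂ K K) (f g : Fn K n) (t : K)
    (h : ∀ i, coeffDer (Fin n → ℤ) δ (t • dLog K i g) = dLog K i f) (η : Form K n (n - 1)) :
    (extD K n n - t • dWedge n g) (connOp (n - 1) δ f η) =
      connOp n δ f ((extD K n n - t • dWedge n g) η) := by
  ext1 S
  rw [connOp_apply]
  have e : ∀ ξ : Form K n (n - 1),
      (extD K n n - t • dWedge n g) ξ S =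
      ∑ i : {i // i ∈ S.1}, (-1 : K) ^ (S.1.filter fun j => j < i.1).card •
        (dLog K i.1 (ξ ⟨S.1.erase i.1, by rw [Finset.card_erase_of_mem i.2, S.2]⟩) -
          (t • dLog K i.1 g) *
            ξ ⟨S.1.erase i.1, by rw [Finset.card_erase_of_mem i.2, S.2]⟩) := by
    intro ξ
    simp only [extD, dWedge, frameWedge, LinearMap.sub_apply, LinearMap.smul_apply, Pi.sub_apply,
      Pi.smul_apply, LinearMap.pi_apply, LinearMap.sum_apply, LinearMap.comp_apply,
      LinearMap.proj_apply, LinearMap.mulLeft_apply, Finset.smul_sum, smul_sub,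
      Finset.sum_sub_distrib, smul_mul_assoc]
    congr 1
    refine Finset.sum_congr rfl fun i _ => ?_
    rw [smul_comm]
  rw [e, e, map_sum, Finset.mul_sum, ← Finset.sum_sub_distrib]
  refine Finset.sum_congr rfl fun i _ => ?_
  have hsign : δ ((-1 : K) ^ (S.1.filter fun j => j < i.1).card) = 0 := by
    rcases neg_one_pow_eq_or K (S.1.filter fun j => j < i.1).card with h | h <;>
      rw [h] <;> simp
  rw [coeffDer_smul, hsign, zero_smul, zero_add, mul_smul_comm, ← smul_sub, connOp_apply]
  congr 1
  simp only [map_sub, Derivation.leibniz, h, coeffDer_dLog, smul_eq_mul]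
  ring

end

theorem systemRel_le {n : ℕ} (w : Fin n → ℕ) (δ : Derivation ℂ LxTau LxTau) (f : Fn LxTau n)
    (h : ∀ i, coeffDer (Fin n → ℤ) δ
        ((LaurentPolynomial.T 1 : LxTau) • dLog LxTau i (potential LxTau w)) = dLog LxTau i f) :
    (systemRel w).restrictScalars ℂ ≤
      ((systemRel w).restrictScalars ℂ).comap (connOp n δ f) := by
  rintro _ ⟨η, rfl⟩
  exact ⟨connOp (n - 1) δ f η, connOp_comm δ f _ _ h η⟩

/-- The operator on `G` induced by `η ↦ δ η - f η`. -/
def connOnG {n : ℕ} (w : Fin n → ℕ) (δ : Derivation ℂ LxTau LxTau) (f : Fn LxTau n)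
    (h : ∀ i, coeffDer (Fin n → ℤ) δ
        ((LaurentPolynomial.T 1 : LxTau) • dLog LxTau i (potential LxTau w)) = dLog LxTau i f) :
    G w →ₗ[ℂ] G w :=
  ((Submodule.Quotient.restrictScalarsEquiv ℂ (systemRel w)).toLinearMap ∘ₗ
    Submodule.mapQ _ _ (connOp n δ f) (systemRel_le w δ f h)) ∘ₗ
      (Submodule.Quotient.restrictScalarsEquiv ℂ (systemRel w)).symm.toLinearMap

theorem dTau_T : dTau (LaurentPolynomial.T 1) = 1 := by
  change (LaurentPolynomial.T (-1) : LxTau) * eulerDer Lx (AddMonoidHom.id ℤ) _ = 1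
  rw [LaurentPolynomial.T, LaurentPolynomial.T, eulerDer_single,
    AddMonoidAlgebra.single_mul_single]
  simp

theorem dTau_C (a : Lx) : dTau (LaurentPolynomial.C a) = 0 := by
  change (LaurentPolynomial.T (-1) : LxTau) * eulerDer Lx (AddMonoidHom.id ℤ) _ = 0
  rw [← LaurentPolynomial.single_eq_C, eulerDer_single]
  simp

theorem dX_T (k : ℤ) : dX (LaurentPolynomial.T k) = 0 := by
  rw [dX, LaurentPolynomial.T, coeffDer_single]
  simp

theorem tau_compat {n : ℕ} (w : Fin n → ℕ) (i : Fin n) :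
    coeffDer (Fin n → ℤ) dTau
        ((LaurentPolynomial.T 1 : LxTau) • dLog LxTau i (potential LxTau w)) =
      dLog LxTau i (potential LxTau w) := by
  have h : coeffDer (Fin n → ℤ) dTau (potential LxTau w) = 0 := by
    have h1 : dTau (algebraMap Lx LxTau (LaurentPolynomial.T 1)) = 0 := dTau_C _
    simp only [potential, map_add, map_sum, coeffDer_single, h1]
    simp
  rw [coeffDer_smul, dTau_T, one_smul, coeffDer_dLog, h, map_zero, smul_zero, add_zero]

theorem x_compat {n : ℕ} (w : Fin n → ℕ) (i : Fin n) :
    coeffDer (Fin n → ℤ) dX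
        ((LaurentPolynomial.T 1 : LxTau) • dLog LxTau i (potential LxTau w)) =
      dLog LxTau i ((LaurentPolynomial.T 1 : LxTau) •
        coeffDer (Fin n → ℤ) dX (potential LxTau w)) := by
  rw [coeffDer_smul, dX_T, zero_smul, zero_add, coeffDer_dLog, Derivation.map_smul]

/-- `∇_{∂_τ}` on `G`, induced by `η ↦ ∂η/∂τ - F η`. -/
def nablaTau {n : ℕ} (w : Fin n → ℕ) : G w →ₗ[ℂ] G w :=
  connOnG w dTau (potential LxTau w) (tau_compat w)

/-- `∇_{∂_x}` on `G`, induced by `η ↦ ∂η/∂x - τ (∂F/∂x) η`. -/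
def nablaX {n : ℕ} (w : Fin n → ℕ) : G w →ₗ[ℂ] G w :=
  connOnG w dX
    ((LaurentPolynomial.T 1 : LxTau) • coeffDer (Fin n → ℤ) dX (potential LxTau w)) (x_compat w)

theorem nablaTau_mk {n : ℕ} (w : Fin n → ℕ) (η : Form LxTau n n) :
    nablaTau w ((systemRel w).mkQ η) =
      (systemRel w).mkQ (connOp n dTau (potential LxTau w) η) := rfl

theorem nablaX_mk {n : ℕ} (w : Fin n → ℕ) (η : Form LxTau n n) :
    nablaX w ((systemRel w).mkQ η) = (systemRel w).mkQ (connOp n dX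
      ((LaurentPolynomial.T 1 : LxTau) • coeffDer (Fin n → ℤ) dX (potential LxTau w)) η) := rfl

/-- `∇_{∂_θ} = -τ² ∇_{∂_τ}` on `G`, where `θ = τ⁻¹`. -/
def nablaTheta {n : ℕ} (w : Fin n → ℕ) (g : G w) : G w :=
  -((LaurentPolynomial.T 2 : LxTau) • nablaTau w g)

/-! ### Combinatorics of the weights -/

/-- `μ = 1 + w₁ + ⋯ + wₙ`. -/
def mu {n : ℕ} (w : Fin n → ℕ) : ℕ := 1 + ∑ i, w i

/-- The weights `w₀ = 1, w₁, …, wₙ`. -/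
def wt {n : ℕ} (w : Fin n → ℕ) : Fin (n + 1) → ℕ := Fin.cons 1 w

/-- The disjoint union (as a multiset) of the sets `{ℓ μ / wᵢ | 0 ≤ ℓ < wᵢ}`, `0 ≤ i ≤ n`. -/
def sMultiset {n : ℕ} (w : Fin n → ℕ) : Multiset ℚ :=
  ∑ i : Fin (n + 1),
    (Multiset.range (wt w i)).map fun l : ℕ => (l : ℚ) * (mu w : ℚ) / (wt w i : ℚ)

/-- The numbers `s₀ ≤ s₁ ≤ ⋯ ≤ s_{μ-1}` (the value at `k ≥ μ` plays no role). -/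
def s {n : ℕ} (w : Fin n → ℕ) (k : ℕ) : ℚ := ((sMultiset w).sort (· ≤ ·)).getD k 0

/-- `α_k = k - s_k`. -/
def alpha {n : ℕ} (w : Fin n → ℕ) (k : ℕ) : ℚ := (k : ℚ) - s w k

/-- The smallest index `i ∈ {0, …, n}` at which `aᵢ / wᵢ` is minimal. -/
def minIndex {n : ℕ} (w : Fin n → ℕ) (a : Fin (n + 1) → ℕ) : Fin (n + 1) :=
  (Finset.univ.filter fun i : Fin (n + 1) =>
      ∀ j, (a i : ℚ) / (wt w i : ℚ) ≤ (a j : ℚ) / (wt w j : ℚ)).min' (by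
    obtain ⟨i, -, hi⟩ := Finset.exists_min_image (Finset.univ : Finset (Fin (n + 1)))
      (fun i => (a i : ℚ) / (wt w i : ℚ)) ⟨0, Finset.mem_univ _⟩
    exact ⟨i, Finset.mem_filter.2 ⟨Finset.mem_univ _, fun j => hi j (Finset.mem_univ _)⟩⟩)

/-- The multi-indices `a(k) ∈ ℕ^{n+1}`: `a(0) = 0`, and `a(k+1)` is `a(k)` with the entry at
`minIndex (a(k))` increased by one. -/
def multiIndex {n : ℕ} (w : Fin n → ℕ) : ℕ → Fin (n + 1) → ℕ
  | 0 => 0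
  | k + 1 => multiIndex w k + Pi.single (minIndex w (multiIndex w k)) 1

/-- `ω_k = ∏ᵢ wᵢ^{-a(k)ᵢ} · u₀^{a(k)₀} u₁^{a(k)₁} ⋯ uₙ^{a(k)ₙ} · du₁/u₁ ∧ ⋯ ∧ duₙ/uₙ`
with `u₀ = 1 / (u₁^{w₁} ⋯ uₙ^{wₙ})`. -/
def omegaForm (K : Type) [CommRing K] [Algebra ℂ K] {n : ℕ} (w : Fin n → ℕ) (k : ℕ) :
    Form K n n :=
  topForm (AddMonoidAlgebra.single
    (fun i => (multiIndex w k i.succ : ℤ) - (multiIndex w k 0 : ℤ) * (w i : ℤ))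
    (algebraMap ℂ K (∏ i, ((w i : ℂ) ^ multiIndex w k i.succ)⁻¹)))

/-- The class of `ω_k` in the Brieskorn lattice `G₀`. -/
def omega {n : ℕ} (w : Fin n → ℕ) (k : ℕ) : G0 w := (latticeRel w).mkQ (omegaForm LxTheta w k)

/-! ### The matrices of the connection -/

/-- `A₀(x)`: first column `μ x e₁`, column `k` equal to `μ e_{k+1}` for `1 ≤ k ≤ μ - 2`, last
column `μ / (w₁^{w₁} ⋯ wₙ^{wₙ}) e₀`. -/
def A0 {n : ℕ} (w : Fin n → ℕ) : Matrix (Fin (mu w)) (Fin (mu w)) Lx :=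
  Matrix.of fun i j =>
    if j.val + 1 = i.val then
      if j.val = 0 then algebraMap ℂ Lx (mu w : ℂ) * LaurentPolynomial.T 1
      else algebraMap ℂ Lx (mu w : ℂ)
    else if i.val = 0 ∧ j.val + 1 = mu w then
      algebraMap ℂ Lx ((mu w : ℂ) / ∏ i, (w i : ℂ) ^ w i)
    else 0

/-- `A_∞ = diag(α₀, …, α_{μ-1})`. -/
def AInf {n : ℕ} (w : Fin n → ℕ) : Matrix (Fin (mu w)) (Fin (mu w)) ℂ :=
  Matrix.diagonal fun k => ((alpha w k.val : ℚ) : ℂ)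

/-- `R = diag(0, -1, …, -1, -s_{μ-1}/μ, …, -s_{n+1}/μ)`, with `n` entries `-1`. -/
def R {n : ℕ} (w : Fin n → ℕ) : Matrix (Fin (mu w)) (Fin (mu w)) ℂ :=
  Matrix.diagonal fun k =>
    if k.val = 0 then 0
    else if k.val ≤ n then -1
    else ((-(s w (mu w + n - k.val)) / (mu w : ℚ) : ℚ) : ℂ)

/-- The coefficient of `dθ` in `(A₀(x)/θ + A_∞) dθ/θ`, where `1/θ = τ`. -/
def connTheta {n : ℕ} (w : Fin n → ℕ) : Matrix (Fin (mu w)) (Fin (mu w)) LxTau :=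
  (LaurentPolynomial.T 1 : LxTau) •
    ((LaurentPolynomial.T 1 : LxTau) • (A0 w).map (algebraMap Lx LxTau) +
      (AInf w).map (algebraMap ℂ LxTau))

/-- The coefficient of `dx` in `(R - A₀(x)/(μθ)) dx/x`, where `1/θ = τ`. -/
def connX {n : ℕ} (w : Fin n → ℕ) : Matrix (Fin (mu w)) (Fin (mu w)) LxTau :=
  algebraMap Lx LxTau (LaurentPolynomial.T (-1)) •
    ((R w).map (algebraMap ℂ LxTau) -
      (algebraMap ℂ LxTau (mu w : ℂ)⁻¹ * LaurentPolynomial.T 1) •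
        (A0 w).map (algebraMap Lx LxTau))

end

end Brieskorn

/-! In coordinates, `G₀` and `G` are both the quotient of the Laurent polynomials in `u` by the span
of `θ mᵢ u^m - uᵢ u^m + wᵢ x u₀ u^m` (`latticeRel_eq`, `systemRel_eq`). So the basis statement is
proved once, over a ring `K` with a unit `x`, an element `t` in the role of `θ`, and a derivation
`δ` in the role of `x ∂/∂x`.

The main tool is `D = x u₀ - t δ`, which is `-θ ∇_{x∂_x}`. Modulo the relations, `uᵢ u^m = (wᵢ D +
mᵢ t) u^m`. Moreover `D ω₀ = x ω₁`, `D ω_k = ω_{k+1} + t (1 - s_k/μ) ω_k` for `1 ≤ k < μ`, and `ω_μ`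
is a constant times `ω₀`.

Generation (`span_relSub_omegaFn`): the span of the relations and the `ω_k` is stable under `D`, so
the monomials in it are stable under `u₀`, then under each `uᵢ`, and it contains `1 = ω₀`.

Independence (`exists_realization`): give `K^μ` the operator `D` defined by the recursion above,
send `u^m` to `∏ᵢ ∏_{l<mᵢ} (wᵢ D + l t) e₀` and let `u₀` act as `x⁻¹ D`. This is consistent with `u₀
u^w = 1`, kills the relations and sends `ω_k` to `e_k`.

Matrices: the greedy choice of `a(k)` merges the sequences `ℓ/wᵢ` in increasing order, so its
minimal ratio at step `k` is `s_k/μ` (`s_eq`). On `ω_k`, `∇_{∂_θ}` is multiplication by `τ² F`, with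
`F u^m ≡ θ (∑ mᵢ) u^m + μ x u₀ u^m`, and `∇_{∂_x}` is multiplication by `-τ u₀`. The order of the
entries of `R` comes from the symmetry `s_{μ+n-k} = μ - s_k` (`s_reflect`). -/

namespace Brieskorn

/-! ### Combinatorics of the multi-indices -/

section Combinatorics

variable {n : ℕ} (w : Fin n → ℕ)

theorem wt_succ (i : Fin n) : wt w i.succ = w i := rfl

theorem wt_pos (hw : ∀ i, 0 < w i) (i : Fin (n + 1)) : 0 < wt w i := by
  refine Fin.cases ?_ (fun j => ?_) i
  · exact one_pos
  · exact hw j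

theorem sum_wt : ∑ i, wt w i = mu w := by
  rw [Fin.sum_univ_succ]; rfl

theorem mu_pos : 0 < mu w := by unfold mu; omega

theorem lt_mu (hw : ∀ i, 0 < w i) : n < mu w := by
  have : ∑ _i : Fin n, 1 ≤ ∑ i, w i := Finset.sum_le_sum fun i _ => hw i
  simp at this
  unfold mu; omega

theorem minIndex_mem (a : Fin (n + 1) → ℕ) (j : Fin (n + 1)) :
    (a (minIndex w a) : ℚ) / (wt w (minIndex w a) : ℚ) ≤ (a j : ℚ) / (wt w j : ℚ) := by
  have h := Finset.min'_mem (Finset.univ.filter fun i : Fin (n + 1) =>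
      ∀ j, (a i : ℚ) / (wt w i : ℚ) ≤ (a j : ℚ) / (wt w j : ℚ)) (by
    obtain ⟨i, -, hi⟩ := Finset.exists_min_image (Finset.univ : Finset (Fin (n + 1)))
      (fun i => (a i : ℚ) / (wt w i : ℚ)) ⟨0, Finset.mem_univ _⟩
    exact ⟨i, Finset.mem_filter.2 ⟨Finset.mem_univ _, fun j => hi j (Finset.mem_univ _)⟩⟩)
  exact (Finset.mem_filter.1 h).2 j

/-- All ratios vanish here, so the tie-breaking rule decides; this is what makes `ω₁` the form with
coefficient `u₀`. -/
theorem minIndex_zero : minIndex w 0 = 0 := by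
  refine le_antisymm (Finset.min'_le _ _ ?_) (Fin.zero_le _)
  simp

theorem multiIndex_succ (k : ℕ) :
    multiIndex w (k + 1) = multiIndex w k + Pi.single (minIndex w (multiIndex w k)) 1 := rfl

theorem multiIndex_one : multiIndex w 1 = Pi.single 0 1 := by
  rw [multiIndex_succ]
  change 0 + Pi.single (minIndex w 0) 1 = _
  rw [minIndex_zero, zero_add]

theorem sum_multiIndex (k : ℕ) : ∑ i, multiIndex w k i = k := by
  induction k with
  | zero => simp [multiIndex]
  | succ k ih => simp [multiIndex_succ, Finset.sum_add_distrib, ih]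

theorem multiIndex_mono (i : Fin (n + 1)) : Monotone fun k => multiIndex w k i :=
  monotone_nat_of_le_succ fun k => by simp [multiIndex_succ]

/-- The minimum of the `a(k)ᵢ / wᵢ`. -/
noncomputable def minRatio (k : ℕ) : ℚ :=
  (multiIndex w k (minIndex w (multiIndex w k)) : ℚ) /
    (wt w (minIndex w (multiIndex w k)) : ℚ)

theorem minRatio_mono : Monotone (minRatio w) :=
  monotone_nat_of_le_succ fun k => by
    refine (minIndex_mem w (multiIndex w k) (minIndex w (multiIndex w (k + 1)))).trans ?_
    unfold minRatio
    gcongr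
    exact multiIndex_mono w _ (Nat.le_succ k)

/-- Since the entries of `a(k)` sum to `k < μ = ∑ wᵢ`, some ratio is below `1`, hence so is the
minimal one. -/
theorem multiIndex_minIndex_lt (hw : ∀ i, 0 < w i) {k : ℕ} (hk : k < mu w) :
    multiIndex w k (minIndex w (multiIndex w k)) < wt w (minIndex w (multiIndex w k)) := by
  obtain ⟨j, -, hj⟩ : ∃ j ∈ Finset.univ, multiIndex w k j < wt w j := by
    refine Finset.exists_lt_of_sum_lt ?_
    rwa [sum_multiIndex, sum_wt]
  have h := minIndex_mem w (multiIndex w k) j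
  have h1 : (multiIndex w k j : ℚ) / (wt w j : ℚ) < 1 := by
    rw [div_lt_one (by exact_mod_cast wt_pos w hw j)]
    exact_mod_cast hj
  have h2 := h.trans_lt h1
  rw [div_lt_one (by exact_mod_cast wt_pos w hw _)] at h2
  exact_mod_cast h2

theorem multiIndex_le_wt (hw : ∀ i, 0 < w i) {k : ℕ} (hk : k ≤ mu w) (i : Fin (n + 1)) :
    multiIndex w k i ≤ wt w i := by
  induction k with
  | zero => exact Nat.zero_le _
  | succ k ih =>
    rw [multiIndex_succ, Pi.add_apply]
    by_cases h : i = minIndex w (multiIndex w k)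
    · subst h
      rw [Pi.single_eq_same]
      exact multiIndex_minIndex_lt w hw hk
    · rw [Pi.single_eq_of_ne h]
      exact ih (by omega)

theorem multiIndex_mu (hw : ∀ i, 0 < w i) : multiIndex w (mu w) = wt w := by
  funext i
  refine (Finset.sum_eq_sum_iff_of_le
    (fun i _ => multiIndex_le_wt w hw le_rfl i)).1 ?_ i (Finset.mem_univ i)
  rw [sum_multiIndex, sum_wt]

theorem multiIndex_zero_eq_one (hw : ∀ i, 0 < w i) {k : ℕ} (h1 : 1 ≤ k) (hk : k ≤ mu w) :
    multiIndex w k 0 = 1 := by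
  refine le_antisymm (multiIndex_le_wt w hw hk 0) ?_
  have := multiIndex_mono w 0 h1
  simpa [multiIndex_one] using this

/-- The entry at index `0` reaches its bound `w₀ = 1` at the first step, so it cannot be chosen
again before `μ`. -/
theorem exists_minIndex_eq_succ (hw : ∀ i, 0 < w i) {k : ℕ} (h1 : 1 ≤ k) (hk : k < mu w) :
    ∃ i : Fin n, minIndex w (multiIndex w k) = i.succ := by
  refine Fin.exists_succ_eq.2 (fun h => ?_) |>.imp fun _ => Eq.symm
  have h2 := multiIndex_zero_eq_one w hw (k := k + 1) (by omega) hk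
  rw [multiIndex_succ, h, Pi.add_apply, multiIndex_zero_eq_one w hw h1 hk.le] at h2
  simp at h2

/-- Each step consumes the ratio `a(k)ᵢ/wᵢ` at the chosen index and increases `a(k)ᵢ`, so after `k`
steps exactly the ratios `l/wᵢ` with `l < a(k)ᵢ` have been consumed. -/
theorem map_range_minRatio (k : ℕ) :
    (Multiset.range k).map (fun j => minRatio w j * mu w) =
      ∑ i : Fin (n + 1), (Multiset.range (multiIndex w k i)).map
        fun l : ℕ => (l : ℚ) * (mu w : ℚ) / (wt w i : ℚ) := by
  induction k with
  | zero => simp [multiIndex]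
  | succ k ih =>
    set i₀ := minIndex w (multiIndex w k) with hi₀
    rw [Multiset.range_succ, Multiset.map_cons, ih, ← Multiset.singleton_add]
    rw [← Finset.add_sum_erase _ _ (Finset.mem_univ i₀),
      ← Finset.add_sum_erase (a := i₀) _ _ (Finset.mem_univ i₀), ← add_assoc]
    congr 1
    · rw [multiIndex_succ, ← hi₀, Pi.add_apply, Pi.single_eq_same, Multiset.range_succ,
        Multiset.map_cons, Multiset.singleton_add]
      congr 1
      rw [minRatio, ← hi₀]; ring
    · refine Finset.sum_congr rfl fun i hi => ?_
      rw [multiIndex_succ, ← hi₀, Pi.add_apply, Pi.single_eq_of_ne (Finset.ne_of_mem_erase hi),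
        add_zero]

theorem sort_eq_of_pairwise {l : List ℚ} {m : Multiset ℚ} (hl : l.Pairwise (· ≤ ·))
    (h : (l : Multiset ℚ) = m) : m.sort (· ≤ ·) = l := by
  subst h
  exact ((Multiset.coe_eq_coe.1 (Multiset.sort_eq (l : Multiset ℚ) (· ≤ ·)))).eq_of_pairwise'
    (Multiset.pairwise_sort _ _) hl

/-- The consumed ratios are nondecreasing, and at `k = μ`, where `a(μ) = (w₀, …, wₙ)`, they exhaust
the multiset; so they are its sorted list. -/
theorem s_eq (hw : ∀ i, 0 < w i) {k : ℕ} (hk : k < mu w) : s w k = minRatio w k * mu w := by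
  have h : (sMultiset w).sort (· ≤ ·) = (List.range (mu w)).map fun j => minRatio w j * mu w := by
    refine sort_eq_of_pairwise ?_ ?_
    · rw [List.pairwise_map]
      refine List.pairwise_lt_range.imp fun hab => ?_
      gcongr
      exact minRatio_mono w hab.le
    · have := map_range_minRatio w (mu w)
      rw [multiIndex_mu w hw] at this
      exact this
  rw [s, h, List.getD_eq_getElem _ _ (by simpa using hk)]
  simp

/-! ### The symmetry of the numbers `s_k` -/

/-- The nonzero elements of `sMultiset w`. -/
noncomputable def sPos : Multiset ℚ :=
  ∑ i : Fin (n + 1),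
    (Multiset.range (wt w i - 1)).map fun l : ℕ => ((l : ℚ) + 1) * (mu w : ℚ) / (wt w i : ℚ)

theorem sMultiset_eq (hw : ∀ i, 0 < w i) :
    sMultiset w = Multiset.replicate (n + 1) 0 + sPos w := by
  have h : ∀ i : Fin (n + 1), ((Multiset.range (wt w i)).map fun l : ℕ =>
      (l : ℚ) * (mu w : ℚ) / (wt w i : ℚ)) = {0} + (Multiset.range (wt w i - 1)).map
        fun l : ℕ => ((l : ℚ) + 1) * (mu w : ℚ) / (wt w i : ℚ) := by
    intro i
    obtain ⟨m, hm⟩ : ∃ m, wt w i = m + 1 := ⟨wt w i - 1, by have := wt_pos w hw i; omega⟩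
    rw [hm, Nat.add_sub_cancel, Multiset.range, Multiset.range, Multiset.map_coe,
      Multiset.map_coe, List.range_succ_eq_map]
    simp [Function.comp_def]
  rw [sMultiset, Finset.sum_congr rfl fun i _ => h i, Finset.sum_add_distrib, sPos]
  simp [Multiset.nsmul_singleton]

theorem map_sub_sPos (hw : ∀ i, 0 < w i) : (sPos w).map (fun v => (mu w : ℚ) - v) = sPos w := by
  rw [sPos, ← Multiset.coe_mapAddMonoidHom, map_sum]
  refine Finset.sum_congr rfl fun i _ => ?_
  rw [Multiset.coe_mapAddMonoidHom, Multiset.map_map]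
  -- The index `l` stands for `ℓ = l + 1`, so the reflection `ℓ ↦ wᵢ - ℓ` becomes `l ↦ wᵢ - 2 - l`.
  have hr : (Multiset.range (wt w i - 1)).map (fun l => wt w i - 1 - 1 - l) =
      Multiset.range (wt w i - 1) := by
    have h := List.reverse_range' (s := 0) (n := wt w i - 1)
    rw [← List.range_eq_range', zero_add] at h
    rw [Multiset.range, Multiset.map_coe, ← h, Multiset.coe_reverse]
  conv_rhs => rw [← hr, Multiset.map_map]
  refine Multiset.map_congr rfl fun l hl => ?_
  have hl' := Multiset.mem_range.1 hl
  have h0 : (wt w i : ℚ) ≠ 0 := by exact_mod_cast (wt_pos w hw i).ne'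
  have h1 : ((wt w i - 1 - 1 - l : ℕ) : ℚ) = (wt w i : ℚ) - 1 - 1 - l := by
    rw [Nat.cast_sub (by omega), Nat.cast_sub (by omega), Nat.cast_sub (by omega)]; simp
  simp only [Function.comp, h1]
  field_simp
  ring

theorem sort_sMultiset (hw : ∀ i, 0 < w i) : (sMultiset w).sort (· ≤ ·) =
    List.replicate (n + 1) 0 ++ (sPos w).sort (· ≤ ·) := by
  refine sort_eq_of_pairwise ?_ ?_
  · rw [List.pairwise_append]
    refine ⟨by simp, Multiset.pairwise_sort _ _, fun a ha b hb => ?_⟩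
    rw [List.eq_of_mem_replicate ha]
    rw [Multiset.mem_sort, sPos, Multiset.mem_sum] at hb
    obtain ⟨i, -, hi⟩ := hb
    obtain ⟨l, -, rfl⟩ := Multiset.mem_map.1 hi
    positivity
  · rw [sMultiset_eq w hw, ← Multiset.coe_add, Multiset.sort_eq, Multiset.coe_replicate]

theorem s_eq_zero (hw : ∀ i, 0 < w i) {k : ℕ} (hk : k ≤ n) : s w k = 0 := by
  rw [s, sort_sMultiset w hw, List.getD_append _ _ _ _ (by simpa using hk)]
  rw [List.getD_replicate _ (by omega)]

theorem card_sPos (hw : ∀ i, 0 < w i) : (sPos w).card + n + 1 = mu w := by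
  have h := congrArg Multiset.card (sMultiset_eq w hw)
  rw [sMultiset, Multiset.card_sum] at h
  simp [sum_wt] at h
  omega

/-- The sorted list is `n + 1` zeros followed by a list invariant under `v ↦ μ - v`; this decreasing
map reverses that list. -/
theorem s_reflect (hw : ∀ i, 0 < w i) {k : ℕ} (hk : n < k) (hk' : k < mu w) :
    s w (mu w + n - k) = mu w - s w k := by
  set L := (sPos w).sort (· ≤ ·) with hL
  have hlen : L.length + n + 1 = mu w := by rw [hL, Multiset.length_sort, card_sPos w hw]
  have hrev : L = (L.map fun v => (mu w : ℚ) - v).reverse := by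
    refine sort_eq_of_pairwise ?_ ?_
    · rw [List.pairwise_reverse, List.pairwise_map]
      refine (Multiset.pairwise_sort (sPos w) (· ≤ ·)).imp fun h => ?_
      exact sub_le_sub_left h _
    · rw [Multiset.coe_reverse, ← Multiset.map_coe, hL, Multiset.sort_eq, map_sub_sPos w hw]
  have hs : ∀ j, n < j → s w j = L.getD (j - (n + 1)) 0 := by
    intro j hj
    rw [s, sort_sMultiset w hw, List.getD_append_right _ _ _ _ (by simpa using hj)]
    simp [hL]
  rw [hs _ (by omega), hs _ hk, List.getD_eq_getElem _ _ (by omega),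
    List.getD_eq_getElem _ _ (by omega)]
  have h2 : mu w + n - k - (n + 1) < ((L.map fun v => (mu w : ℚ) - v).reverse).length := by
    simp; omega
  have h3 : L[mu w + n - k - (n + 1)]'(by omega) =
      ((L.map fun v => (mu w : ℚ) - v).reverse)[mu w + n - k - (n + 1)]'h2 := by
    congr 1
  rw [h3, List.getElem_reverse, List.getElem_map]
  congr 2
  simp
  omega

end Combinatorics

end Brieskorn

namespace Brieskorn

noncomputable section

/-! ### Products of commuting operators and iterated lifts -/

theorem prod_prod_range_add_single {R : Type*} [CommMonoid R] {n : ℕ} (g : Fin n → ℕ → R)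
    (m : Fin n → ℕ) (i : Fin n) :
    ∏ j, ∏ l ∈ Finset.range ((m + Pi.single i 1 : Fin n → ℕ) j), g j l =
      g i (m i) * ∏ j, ∏ l ∈ Finset.range (m j), g j l := by
  rw [← Finset.mul_prod_erase _ _ (Finset.mem_univ i),
    ← Finset.mul_prod_erase (a := i) Finset.univ
      (fun j => ∏ l ∈ Finset.range (m j), g j l) (Finset.mem_univ i), ← mul_assoc]
  congr 1
  · rw [Pi.add_apply, Pi.single_eq_same, Finset.prod_range_succ, mul_comm]
  · refine Finset.prod_congr rfl fun j hj => ?_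
    rw [Pi.add_apply, Pi.single_eq_of_ne (Finset.ne_of_mem_erase hj), add_zero]

/-- For commuting `D` and `t` the products `∏ᵢ ∏_{l < mᵢ} (wᵢ D + l t)` make sense. -/
theorem exists_commuting_products {R : Type*} [Ring R] {D t : R} (h : Commute D t) {n : ℕ}
    (w : Fin n → ℕ) : ∃ Q : (Fin n → ℕ) → R, Q 0 = 1 ∧
      ∀ m i, Q (m + Pi.single i 1) = ((w i : R) * D + (m i : R) * t) * Q m := by
  -- The finite products are formed in the commutative subring generated by `D` and `t`.
  have hcomm : IsMulCommutative (Subring.closure ({D, t} : Set R)) :=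
    Subring.isMulCommutative_closure (by
      rintro a (rfl | rfl) b (rfl | rfl)
      exacts [rfl, h, h.symm, rfl])
  let _ : CommRing (Subring.closure ({D, t} : Set R)) :=
    { (inferInstance : Ring (Subring.closure ({D, t} : Set R))) with
      mul_comm := hcomm.is_comm.comm }
  let D' : Subring.closure ({D, t} : Set R) := ⟨D, Subring.subset_closure (by simp)⟩
  let t' : Subring.closure ({D, t} : Set R) := ⟨t, Subring.subset_closure (by simp)⟩
  refine ⟨fun m => ((∏ j, ∏ l ∈ Finset.range (m j), ((w j : Subring.closure ({D, t} : Set R)) * D' +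
    (l : Subring.closure ({D, t} : Set R)) * t') : Subring.closure ({D, t} : Set R)) : R), ?_, ?_⟩
  · simp
  · intro m i
    exact congrArg Subtype.val (prod_prod_range_add_single
      (fun j l => (w j : Subring.closure ({D, t} : Set R)) * D' +
        (l : Subring.closure ({D, t} : Set R)) * t') m i)

/-- A function `V` on `ℕⁿ` with `E (V (m + w)) = V m` extends to `ℤⁿ`. -/
theorem exists_extension {N : Type*} {n : ℕ} (w : Fin n → ℕ) (hw : ∀ i, 0 < w i)
    (V : (Fin n → ℕ) → N) (E : N → N) (h : ∀ m, E (V (m + w)) = V m) :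
    ∃ φ : (Fin n → ℤ) → N, ∀ (c : ℕ) (m : Fin n → ℕ) (z : Fin n → ℤ),
      (∀ i, z i + c * w i = m i) → φ z = E^[c] (V m) := by
  -- Two ways of writing `z = m - c w` with `m ∈ ℕⁿ` differ by a multiple of `w`, so this gives
  -- independence of the choice.
  have hiter : ∀ (d c : ℕ) (m : Fin n → ℕ), E^[c + d] (V (m + d • w)) = E^[c] (V m) := by
    intro d
    induction d with
    | zero => intro c m; simp
    | succ d ih =>
      intro c m
      rw [← add_assoc, Function.iterate_succ_apply, succ_nsmul, ← add_assoc, h, ih]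
  have huniq : ∀ (c c' : ℕ) (m m' : Fin n → ℕ) (z : Fin n → ℤ), c ≤ c' →
      (∀ i, z i + c * w i = m i) → (∀ i, z i + c' * w i = m' i) →
      E^[c] (V m) = E^[c'] (V m') := by
    intro c c' m m' z hcc hm hm'
    obtain ⟨d, rfl⟩ := Nat.exists_eq_add_of_le hcc
    have : m' = m + d • w := by
      funext i
      have h1 := hm i
      have h2 := hm' i
      push_cast at h2
      rw [add_mul] at h2
      have : ((m' i : ℕ) : ℤ) = ((m + d • w) i : ℕ) := by
        simp only [Pi.add_apply, Pi.smul_apply, smul_eq_mul]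
        push_cast
        linarith
      exact_mod_cast this
    rw [this, hiter]
  -- As every `wᵢ ≥ 1`, the shift `c = ∑ |zᵢ|` is large enough for `z + c w` to be nonnegative.
  refine ⟨fun z => E^[∑ i, (z i).natAbs]
    (V fun i => (z i + (∑ i, (z i).natAbs : ℕ) * w i).toNat), fun c m z hz => ?_⟩
  have hz' : ∀ i, z i + (∑ i, (z i).natAbs : ℕ) * (w i : ℤ) =
      ((z i + (∑ i, (z i).natAbs : ℕ) * (w i : ℤ)).toNat : ℤ) := by
    intro i
    rw [Int.toNat_of_nonneg]
    have h1 : (z i).natAbs ≤ ∑ i, (z i).natAbs :=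
      Finset.single_le_sum (f := fun i => (z i).natAbs) (fun _ _ => Nat.zero_le _)
        (Finset.mem_univ i)
    have h2 : (z i).natAbs ≤ (∑ i, (z i).natAbs) * w i := h1.trans (Nat.le_mul_of_pos_right _ (hw i))
    have h3 : ((z i).natAbs : ℤ) ≤ ((∑ i, (z i).natAbs : ℕ) : ℤ) * (w i : ℤ) := by exact_mod_cast h2
    omega
  rcases le_total (∑ i, (z i).natAbs) c with hle | hle
  · exact huniq _ _ _ _ z hle hz' hz
  · exact (huniq _ _ _ _ z hle hz hz').symm

/-! ### The module with one generator for each monomial -/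

section Monomials

variable {K : Type} [CommRing K]

/-- The relation `t mᵢ u^m - uᵢ u^m + wᵢ x u₀ u^m`. -/
def relElt (x t : K) {n : ℕ} (w : Fin n → ℕ) (i : Fin n) (m : Fin n → ℤ) : Fn K n :=
  AddMonoidAlgebra.single m (t * (m i : K)) - AddMonoidAlgebra.single (m + Pi.single i 1) 1 +
    AddMonoidAlgebra.single (m + fun j => -(w j : ℤ)) ((w i : K) * x)

theorem relElt_add_neg (x t : K) {n : ℕ} (w : Fin n → ℕ) (i : Fin n) (m : Fin n → ℤ) :
    relElt x t w i (m + fun j => -(w j : ℤ)) =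
      AddMonoidAlgebra.single (m + fun j => -(w j : ℤ)) (t * ((m i : K) - (w i : K))) -
      AddMonoidAlgebra.single (m + Pi.single i 1 + fun j => -(w j : ℤ)) 1 +
      AddMonoidAlgebra.single ((m + fun j => -(w j : ℤ)) + fun j => -(w j : ℤ)) ((w i : K) * x) := by
  rw [relElt, add_right_comm m]
  congr 3
  simp [sub_eq_add_neg]

variable [Algebra ℂ K]

/-- The coefficient of `ω_k` on `du₁/u₁ ∧ ⋯ ∧ duₙ/uₙ`. -/
def omegaFn (K : Type) [CommRing K] [Algebra ℂ K] {n : ℕ} (w : Fin n → ℕ) (k : ℕ) : Fn K n :=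
  AddMonoidAlgebra.single
    (fun i => (multiIndex w k i.succ : ℤ) - (multiIndex w k 0 : ℤ) * (w i : ℤ))
    (algebraMap ℂ K (∏ i, ((w i : ℂ) ^ multiIndex w k i.succ)⁻¹))

/-- The normalizing constant `∏ᵢ wᵢ^{a(k)ᵢ}` of `ω_k`. -/
def weightProd {n : ℕ} (w : Fin n → ℕ) (k : ℕ) : ℂ := ∏ i, (w i : ℂ) ^ multiIndex w k i.succ

theorem weightProd_ne_zero {n : ℕ} {w : Fin n → ℕ} (hw : ∀ i, 0 < w i) (k : ℕ) :
    weightProd w k ≠ 0 :=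
  Finset.prod_ne_zero_iff.2 fun i _ => pow_ne_zero _ (by exact_mod_cast (hw i).ne')

theorem omegaFn_eq {n : ℕ} (w : Fin n → ℕ) (k : ℕ) : omegaFn K w k = AddMonoidAlgebra.single
    (fun i => (multiIndex w k i.succ : ℤ) - (multiIndex w k 0 : ℤ) * (w i : ℤ))
    (algebraMap ℂ K (weightProd w k)⁻¹) := by
  rw [omegaFn, weightProd, Finset.prod_inv_distrib]

theorem omegaFn_zero {n : ℕ} (w : Fin n → ℕ) : omegaFn K w 0 = AddMonoidAlgebra.single 0 1 := by
  rw [omegaFn]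
  congr 1
  · funext i; simp [multiIndex]
  · simp [multiIndex]

theorem omegaFn_one {n : ℕ} (w : Fin n → ℕ) :
    omegaFn K w 1 = AddMonoidAlgebra.single (fun j => -(w j : ℤ)) 1 := by
  rw [omegaFn]
  congr 1
  · funext i; simp [multiIndex_one]
  · simp [multiIndex_one]

/-- Because `a(μ) = (w₀, …, wₙ)` and `u₀ u^w = 1`, the sequence closes up; this gives the corner
entry of `A₀`. -/
theorem omegaFn_mu {n : ℕ} (w : Fin n → ℕ) (hw : ∀ i, 0 < w i) :
    omegaFn K w (mu w) = algebraMap ℂ K (∏ i, (w i : ℂ) ^ w i)⁻¹ • omegaFn K w 0 := by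
  rw [omegaFn_zero, omegaFn, multiIndex_mu w hw, AddMonoidAlgebra.smul_single,
    Finset.prod_inv_distrib]
  congr 1
  · funext i; simp [wt]
  · simp [wt]

theorem multiIndex_succ_of_minIndex {n : ℕ} {w : Fin n → ℕ} {k : ℕ} {i : Fin n}
    (hi : minIndex w (multiIndex w k) = i.succ) :
    (fun j : Fin n => multiIndex w (k + 1) j.succ) =
      (fun j => multiIndex w k j.succ) + Pi.single i 1 := by
  funext j
  rw [multiIndex_succ, hi, Pi.add_apply, Pi.add_apply]
  congr 1
  by_cases h : j = i
  · subst h; simp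
  · rw [Pi.single_eq_of_ne h, Pi.single_eq_of_ne (by simpa using h)]

theorem weightProd_succ {n : ℕ} {w : Fin n → ℕ} {k : ℕ} {i : Fin n}
    (hi : minIndex w (multiIndex w k) = i.succ) :
    weightProd w (k + 1) = w i * weightProd w k := by
  have h := prod_prod_range_add_single (fun j (_ : ℕ) => (w j : ℂ))
    (fun j => multiIndex w k j.succ) i
  rw [← multiIndex_succ_of_minIndex hi] at h
  simpa [weightProd] using h

theorem minRatio_eq {n : ℕ} {w : Fin n → ℕ} {k : ℕ} {i : Fin n}
    (hi : minIndex w (multiIndex w k) = i.succ) :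
    minRatio w k = (multiIndex w k i.succ : ℚ) / (w i : ℚ) := by
  rw [minRatio, hi, wt_succ]

theorem mul_minRatio {n : ℕ} {w : Fin n → ℕ} (hw : ∀ i, 0 < w i) {k : ℕ} {i : Fin n}
    (hi : minIndex w (multiIndex w k) = i.succ) :
    (w i : K) * algebraMap ℂ K (minRatio w k : ℂ) = (multiIndex w k i.succ : K) := by
  rw [← map_natCast (algebraMap ℂ K), ← map_natCast (algebraMap ℂ K), ← map_mul, minRatio_eq hi]
  congr 1
  have : (w i : ℂ) ≠ 0 := by exact_mod_cast (hw i).ne'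
  push_cast
  field_simp

/-- Multiplication by `x u₀` on `ω_k`, modulo a relation. -/
theorem single_mul_omegaFn (x t : K) {n : ℕ} {w : Fin n → ℕ} (hw : ∀ i, 0 < w i) {k : ℕ} (h1 : 1 ≤ k) (hk : k < mu w) :
    ∃ (c : K) (i : Fin n) (m : Fin n → ℤ),
      AddMonoidAlgebra.single (fun j => -(w j : ℤ)) x * omegaFn K w k = omegaFn K w (k + 1) +
        (t * algebraMap ℂ K (1 - (minRatio w k : ℂ))) • omegaFn K w k + c • relElt x t w i m := by
  obtain ⟨i, hi⟩ := exists_minIndex_eq_succ w hw h1 hk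
  -- The relation is taken at the exponent of `ω_k` in the chosen direction `i`. That exponent has
  -- `i`-th entry `a(k)ᵢ - wᵢ`, so dividing by `wᵢ` produces the factor `1 - a(k)ᵢ/wᵢ`; the `wᵢ` is
  -- absorbed by the normalization of `ω_{k+1}`.
  refine ⟨algebraMap ℂ K (weightProd w (k + 1))⁻¹, i,
    (fun j => (multiIndex w k j.succ : ℤ)) + fun j => -(w j : ℤ), ?_⟩
  have hwi : (w i : ℂ) ≠ 0 := by exact_mod_cast (hw i).ne'
  have hm := mul_minRatio (K := K) hw hi
  have hW : algebraMap ℂ K (weightProd w (k + 1))⁻¹ * (w i : K) =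
      algebraMap ℂ K (weightProd w k)⁻¹ := by
    rw [weightProd_succ hi, ← map_natCast (algebraMap ℂ K), ← map_mul]
    congr 1
    field_simp
  have e1 : (fun j => (multiIndex w k j.succ : ℤ) - (multiIndex w k 0 : ℤ) * (w j : ℤ)) =
      (fun j => (multiIndex w k j.succ : ℤ)) + fun j => -(w j : ℤ) := by
    funext j
    rw [multiIndex_zero_eq_one w hw h1 hk.le]
    simp [sub_eq_add_neg]
  have e2 : (fun j => (multiIndex w (k + 1) j.succ : ℤ) -
      (multiIndex w (k + 1) 0 : ℤ) * (w j : ℤ)) =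
      (fun j => (multiIndex w k j.succ : ℤ)) + Pi.single i 1 + fun j => -(w j : ℤ) := by
    funext j
    have := congrFun (multiIndex_succ_of_minIndex hi) j
    simp only [Pi.add_apply] at this
    rw [multiIndex_zero_eq_one w hw (by omega) hk, this]
    by_cases h : j = i
    · subst h; simp [sub_eq_add_neg]
    · simp [h, sub_eq_add_neg]
  rw [relElt_add_neg, omegaFn_eq, omegaFn_eq, e1, e2]
  simp only [smul_add, smul_sub, AddMonoidAlgebra.smul_single, AddMonoidAlgebra.single_mul_single,
    smul_eq_mul, mul_one, Int.cast_natCast]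
  rw [add_comm (fun j : Fin n => -(w j : ℤ))
    ((fun j : Fin n => (multiIndex w k j.succ : ℤ)) + fun j : Fin n => -(w j : ℤ))]
  rw [← mul_assoc (algebraMap ℂ K (weightProd w (k + 1))⁻¹) (w i : K) x, hW,
    mul_comm (algebraMap ℂ K (weightProd w k)⁻¹) x]
  have h3 : t * algebraMap ℂ K (1 - (minRatio w k : ℂ)) * algebraMap ℂ K (weightProd w k)⁻¹ =
      -(algebraMap ℂ K (weightProd w (k + 1))⁻¹ *
        (t * ((multiIndex w k i.succ : K) - (w i : K)))) := by
    rw [← hm, ← hW, map_sub, map_one]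
    ring
  rw [h3, AddMonoidAlgebra.single_neg]
  abel

end Monomials

end

end Brieskorn

namespace Brieskorn

noncomputable section

/-! ### Realizing the relations on a module with an operator -/

section Model

variable {K : Type} [CommRing K] [Algebra ℂ K]

theorem deriv_inverse (δ : Derivation ℂ K K) {x y : K} (hxy : x * y = 1) (hδx : δ x = x) :
    δ y = -y := by
  have h : δ (x * y) = 0 := by rw [hxy]; exact δ.map_one_eq_zero
  rw [Derivation.leibniz, hδx, smul_eq_mul, smul_eq_mul] at h
  linear_combination y * h - (δ y + y) * hxy

/-- A realization of the relations by an operator: if `D` is an operator on `N`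
with `D (f v) = f D v - t δ(f) v`, and the `e k` satisfy the same recursion as the `ω_k`, then there
is a linear map to `N` which kills the relations and sends `ω_k` to `e k`. -/
theorem exists_realization (δ : Derivation ℂ K K) {x y t : K} (hxy : x * y = 1) (hδx : δ x = x)
    (hδt : δ t = 0) {n : ℕ} {w : Fin n → ℕ} (hw : ∀ i, 0 < w i) {N : Type} [AddCommGroup N]
    [Module K N] (D : N →+ N) (hD : ∀ (f : K) v, D (f • v) = f • D v - (t * δ f) • v)
    (e : ℕ → N) (h0 : D (e 0) = x • e 1)
    (hk : ∀ k, 1 ≤ k → k < mu w →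
      D (e k) = e (k + 1) + (t * algebraMap ℂ K (1 - (minRatio w k : ℂ))) • e k)
    (hmu : e (mu w) = algebraMap ℂ K (∏ i, (w i : ℂ) ^ w i)⁻¹ • e 0) :
    ∃ Φ : Fn K n →ₗ[K] N, (∀ i m, Φ (relElt x t w i m) = 0) ∧
      ∀ k, k < mu w → Φ (omegaFn K w k) = e k := by
  have hδy := deriv_inverse δ hxy hδx
  have hDt : ∀ v, D (t • v) = t • D v := fun v => by simp [hD, hδt]
  have hDn : ∀ (m : ℕ) v, D ((m : K) • v) = (m : K) • D v := fun m v => by simp [hD]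
  have hDx : ∀ v, D (x • v) = x • D v - (t * x) • v := fun v => by rw [hD, hδx]
  have hDy : ∀ v, D (y • v) = y • D v + (t * y) • v := fun v => by
    rw [hD, hδy, mul_neg, neg_smul, sub_neg_eq_add]
  have hyx : ∀ v : N, y • x • v = v := fun v => by rw [smul_smul, mul_comm, hxy, one_smul]
  have hxy' : ∀ v : N, x • y • v = v := fun v => by rw [smul_smul, hxy, one_smul]
  let T : AddMonoid.End N := Module.toAddMonoidEnd K N t
  let D' : AddMonoid.End N := D
  have hcomm : Commute D' T := by
    ext v
    exact hDt v
  obtain ⟨Q, hQ0, hQ⟩ := exists_commuting_products hcomm w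
  -- The forced image of `u^m` for `m ∈ ℕⁿ`: the relations turn multiplication by `uᵢ` into `wᵢ D +
  -- mᵢ t`.
  let V : (Fin n → ℕ) → N := fun m => Q m (e 0)
  have hV0 : V 0 = e 0 := by simp [V, hQ0]
  have hV : ∀ m i, V (m + Pi.single i 1) = (w i : K) • D (V m) + ((m i : K) * t) • V m := by
    intro m i
    simp only [V, hQ]
    change ((w i : AddMonoid.End N) (D (Q m (e 0)))) +
      ((m i : AddMonoid.End N) (t • (Q m (e 0)))) = _
    rw [AddMonoid.End.natCast_apply, AddMonoid.End.natCast_apply, Nat.cast_smul_eq_nsmul, mul_smul,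
      Nat.cast_smul_eq_nsmul]
  have hDV : ∀ m i, D (V (m + Pi.single i 1)) =
      (w i : K) • D (D (V m)) + ((m i : K) * t) • D (V m) := by
    intro m i
    rw [hV, map_add, hDn, mul_smul, hDn, hDt, mul_smul]
  -- `D` here stands for multiplication by `x u₀`. In the induction, moving `D` past `x` costs `-t`,
  -- so `wᵢ D + mᵢ t` yields the coefficient `wᵢ(1 - r) - wᵢ + mᵢ` on `t e_k`, with `r` the minimal
  -- ratio; it vanishes as `mᵢ = wᵢ r`.
  have hVk : ∀ k, k + 1 ≤ mu w → D (V fun j => multiIndex w (k + 1) j.succ) =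
      (x * algebraMap ℂ K (weightProd w (k + 1))) • e (k + 1) := by
    intro k
    induction k with
    | zero =>
      intro _
      have : (fun j : Fin n => multiIndex w (0 + 1) j.succ) = 0 := by
        funext j; simp [multiIndex_one]
      rw [this, hV0, h0]
      simp [weightProd, multiIndex_one]
    | succ k ih =>
      intro hk'
      obtain ⟨i, hi⟩ := exists_minIndex_eq_succ w hw (k := k + 1) (by omega) (by omega)
      rw [multiIndex_succ_of_minIndex hi, hDV, ih (by omega), hD, hk _ (by omega) (by omega),
        weightProd_succ hi]
      have hm := mul_minRatio (K := K) hw hi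
      have h1 : δ (x * algebraMap ℂ K (weightProd w (k + 1))) =
          x * algebraMap ℂ K (weightProd w (k + 1)) := by
        rw [Derivation.leibniz, Derivation.map_algebraMap, hδx]
        simp [mul_comm]
      rw [h1, ← hm, map_mul, map_natCast, map_sub, map_one]
      module
  have hVw : D (V w) = x • e 0 := by
    have h1 := hVk (mu w - 1) (by have := mu_pos w; omega)
    rw [Nat.sub_add_cancel (mu_pos w), hmu, smul_smul, mul_assoc, ← map_mul, weightProd,
      multiIndex_mu w hw] at h1
    have h2 : (∏ i, (w i : ℂ) ^ w i) ≠ 0 :=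
      Finset.prod_ne_zero_iff.2 fun i _ => pow_ne_zero _ (by exact_mod_cast (hw i).ne')
    simp only [wt_succ] at h1
    rw [mul_inv_cancel₀ h2, map_one, mul_one] at h1
    exact h1
  -- This is `x u₀ u^{m+w} = x u^m`. From the case `m = 0` one adds one `uᵢ` at a time: the excess
  -- `wᵢ t` in `(mᵢ + wᵢ) t` cancels the term from `D x = x D - t x`.
  have hshift : ∀ m, D (V (m + w)) = x • V m := by
    have key : ∀ (s : ℕ) m, ∑ i, m i = s → D (V (m + w)) = x • V m := by
      intro s
      induction s with
      | zero =>
        intro m hm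
        have : m = 0 := by
          funext i
          exact (Finset.sum_eq_zero_iff.1 hm) i (Finset.mem_univ i)
        rw [this, zero_add, hVw, hV0]
      | succ s ih =>
        intro m hm
        obtain ⟨i, -, hi⟩ : ∃ i ∈ Finset.univ, m i ≠ 0 :=
          Finset.exists_ne_zero_of_sum_ne_zero (by omega)
        obtain ⟨m', rfl⟩ : ∃ m', m = m' + Pi.single i 1 := by
          refine ⟨m - Pi.single i 1, (tsub_add_cancel_of_le ?_).symm⟩
          intro j
          by_cases h : j = i
          · subst h; simpa using Nat.one_le_iff_ne_zero.2 hi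
          · simp [h]
        have hm' : ∑ i, m' i = s := by
          simpa [Finset.sum_add_distrib] using hm
        rw [add_right_comm, hDV, ih m' hm', hV, hDx, Pi.add_apply, Nat.cast_add]
        module
    exact fun m => key _ m rfl
  -- `E` plays the role of multiplication by `u₀`.
  let E : N → N := fun v => y • D v
  -- The commutator `[D, E^c] = c t E^c`, a consequence of `D y = y D + t y`.
  have hE : ∀ c v, E^[c] (D v) + ((c : K) * t) • E^[c] v = D (E^[c] v) := by
    intro c
    induction c with
    | zero => intro v; simp
    | succ c ih =>
      intro v
      rw [Function.iterate_succ_apply', Function.iterate_succ_apply', ← sub_eq_iff_eq_add.2 (ih v).symm]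
      change y • D (D (E^[c] v) - _) + _ • (y • D _) = D (y • D _)
      rw [hDy, map_sub, mul_smul (c : K), hDn, hDt, Nat.cast_succ]
      module
  obtain ⟨φ, hφ⟩ := exists_extension w hw V E fun m => by
    change y • D _ = _
    rw [hshift, hyx]
  have hEadd : ∀ c u v, E^[c] (u + v) = E^[c] u + E^[c] v := by
    intro c
    induction c with
    | zero => intro u v; rfl
    | succ c ih =>
      intro u v
      rw [Function.iterate_succ_apply', ih, Function.iterate_succ_apply',
        Function.iterate_succ_apply']
      change y • D _ = y • D _ + y • D _
      rw [map_add, smul_add]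
  have hEsmul : ∀ c (m : ℕ) v, E^[c] ((m : K) • v) = (m : K) • E^[c] v := by
    intro c m
    induction c with
    | zero => intro v; rfl
    | succ c ih =>
      intro v
      rw [Function.iterate_succ_apply', ih, Function.iterate_succ_apply']
      change y • D _ = _ • y • D _
      rw [hDn, smul_comm]
  have hEt : ∀ c v, E^[c] (t • v) = t • E^[c] v := by
    intro c
    induction c with
    | zero => intro v; rfl
    | succ c ih =>
      intro v
      rw [Function.iterate_succ_apply', ih, Function.iterate_succ_apply']
      change y • D _ = _ • y • D _
      rw [hDt, smul_comm]
  let Φ : Fn K n →ₗ[K] N := (AddMonoidAlgebra.basis (Fin n → ℤ) K).constr K φ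
  have hΦ : ∀ m r, Φ (AddMonoidAlgebra.single m r) = r • φ m := by
    intro m r
    have : (AddMonoidAlgebra.single m r : Fn K n) = r • AddMonoidAlgebra.basis (Fin n → ℤ) K m := by
      simp
    rw [this, map_smul, Module.Basis.constr_basis]
  refine ⟨Φ, ?_, ?_⟩
  · intro i m
    -- One `c` serves all three monomials: `m = a - c w`, `m + eᵢ = (a + eᵢ) - c w` and `m - w = a -
    -- (c + 1) w`. The commutator term `c wᵢ t` then corrects `aᵢ` to `mᵢ`.
    set c := ∑ i, (m i).natAbs with hc
    have hpos : ∀ j, ∃ a : ℕ, m j + c * w j = a := by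
      intro j
      refine Int.eq_ofNat_of_zero_le ?_
      have h1 : (m j).natAbs ≤ c :=
        Finset.single_le_sum (f := fun i => (m i).natAbs) (fun _ _ => Nat.zero_le _)
          (Finset.mem_univ j)
      have h2 : (m j).natAbs ≤ c * w j := h1.trans (Nat.le_mul_of_pos_right _ (hw j))
      have h3 : ((m j).natAbs : ℤ) ≤ (c : ℤ) * (w j : ℤ) := by exact_mod_cast h2
      omega
    choose a ha using hpos
    rw [relElt, map_add, map_sub, hΦ, hΦ, hΦ, hφ c a m ha,
      hφ c (a + Pi.single i 1) (m + Pi.single i 1) (by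
        intro j
        rw [Pi.add_apply, Pi.add_apply, Nat.cast_add, ← ha]
        by_cases h : j = i
        · subst h; simp; ring
        · simp [h]),
      hφ (c + 1) a _ (by
        intro j
        rw [Pi.add_apply, ← ha]
        push_cast
        ring), hV, hEadd, hEsmul, mul_smul (a i : K), hEsmul, hEt, Function.iterate_succ_apply']
    change _ + _ • (y • D _) = 0
    rw [← hE, mul_smul (w i : K) x, hxy']
    have hai : (a i : K) = (m i : K) + c * w i := by
      have := congrArg (Int.cast : ℤ → K) (ha i)
      push_cast at this
      exact this.symm
    rw [hai]
    module
  · intro k hkμ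
    rcases Nat.eq_zero_or_pos k with rfl | h1
    · rw [omegaFn_zero, hΦ, one_smul, hφ 0 0 0 (by simp)]
      exact hV0
    · obtain ⟨k, rfl⟩ : ∃ l, k = l + 1 := ⟨k - 1, by omega⟩
      -- For positive index the power of `u₀` is exactly `1`, so one application of `E` suffices.
      rw [omegaFn_eq, hΦ, hφ 1 (fun j => multiIndex w (k + 1) j.succ) _ (by
        intro j
        rw [multiIndex_zero_eq_one w hw h1 hkμ.le]
        push_cast
        ring)]
      change _ • (y • D _) = _
      rw [hVk k hkμ.le, mul_smul, hyx, smul_smul, ← map_mul,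
        inv_mul_cancel₀ (weightProd_ne_zero hw _), map_one, one_smul]

end Model

end

end Brieskorn

namespace Brieskorn

noncomputable section

/-! ### Generation and independence of the `ω_k` modulo the relations -/

section Presentation

variable {K : Type} [CommRing K]

/-- The module of relations between the monomials `u^m`. -/
def relSub (x t : K) {n : ℕ} (w : Fin n → ℕ) : Submodule K (Fn K n) :=
  Submodule.span K (Set.range fun p : Fin n × (Fin n → ℤ) => relElt x t w p.1 p.2)

theorem relElt_mem (x t : K) {n : ℕ} (w : Fin n → ℕ) (i : Fin n) (m : Fin n → ℤ) :
    relElt x t w i m ∈ relSub x t w :=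
  Submodule.subset_span ⟨(i, m), rfl⟩

/-- A submodule is stable under an operator `D` with `D (f v) = f D v - δ(f) v` if `D` maps a
generating set to it. -/
theorem map_mem_span {N : Type} [AddCommGroup N] [Module K N] (D : N →+ N) (δ : K → K)
    (hD : ∀ (f : K) v, D (f • v) = f • D v - δ f • v) {X : Set N}
    (hX : ∀ v ∈ X, D v ∈ Submodule.span K X) {v : N} (hv : v ∈ Submodule.span K X) :
    D v ∈ Submodule.span K X := by
  induction hv using Submodule.span_induction with
  | mem v hv => exact hX v hv
  | zero => rw [map_zero]; exact zero_mem _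
  | add u v _ _ hu hv => rw [map_add]; exact add_mem hu hv
  | smul f v hv h =>
    rw [hD]
    exact sub_mem (Submodule.smul_mem _ _ h) (Submodule.smul_mem _ _ hv)

variable [Algebra ℂ K]

/-- Multiplication by `x u₀` does not obviously preserve the span, but its twist by `-t δ` does, and
the two agree on monomials with coefficient `1`. -/
theorem span_relSub_omegaFn (δ : Derivation ℂ K K) {x y t : K} (hxy : x * y = 1) (hδx : δ x = x)
    (hδt : δ t = 0) {n : ℕ} {w : Fin n → ℕ} (hw : ∀ i, 0 < w i) :
    relSub x t w ⊔ Submodule.span K (Set.range fun k : Fin (mu w) => omegaFn K w k) = ⊤ := by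
  rw [relSub, ← Submodule.span_union]
  set X : Set (Fn K n) := (Set.range fun p : Fin n × (Fin n → ℤ) => relElt x t w p.1 p.2) ∪
    Set.range fun k : Fin (mu w) => omegaFn K w k with hX
  have hrel : ∀ i m, relElt x t w i m ∈ Submodule.span K X := fun i m =>
    Submodule.subset_span (Or.inl ⟨(i, m), rfl⟩)
  have homega : ∀ k, k ≤ mu w → omegaFn K w k ∈ Submodule.span K X := by
    intro k hk
    rcases hk.lt_or_eq with h | rfl
    · exact Submodule.subset_span (Or.inr ⟨⟨k, h⟩, rfl⟩)
    · rw [omegaFn_mu w hw]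
      exact Submodule.smul_mem _ _ (Submodule.subset_span (Or.inr ⟨⟨0, mu_pos w⟩, rfl⟩))
  let D : Fn K n →+ Fn K n :=
    AddMonoidHom.mulLeft (AddMonoidAlgebra.single (fun j => -(w j : ℤ)) x) -
      AddMonoidHom.mk' (fun g => t • coeffDer (Fin n → ℤ) δ g) (by
        intro a b; rw [map_add, smul_add])
  have hDapp : ∀ v, D v = AddMonoidAlgebra.single (fun j => -(w j : ℤ)) x * v -
      t • coeffDer (Fin n → ℤ) δ v := fun v => rfl
  have hD : ∀ (f : K) v, D (f • v) = f • D v - (t * δ f) • v := by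
    intro f v
    rw [hDapp, hDapp, coeffDer_smul, mul_smul_comm]
    module
  -- Differentiating the coefficient `wᵢ x` contributes `-t wᵢ x`, which changes `mᵢ` into `mᵢ -
  -- wᵢ`, as the relation at the shifted exponent requires.
  have hDrel : ∀ i m, D (relElt x t w i m) =
      x • relElt x t w i (m + fun j => -(w j : ℤ)) := by
    intro i m
    rw [hDapp, relElt_add_neg, relElt]
    simp only [mul_add, mul_sub, map_add, map_sub, coeffDer_single, smul_add, smul_sub,
      AddMonoidAlgebra.smul_single, AddMonoidAlgebra.single_mul_single, smul_eq_mul, mul_one,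
      Derivation.leibniz, Derivation.map_natCast, Derivation.map_intCast,
      Derivation.map_one_eq_zero, hδx, hδt, mul_zero, add_zero, AddMonoidAlgebra.single_zero,
      sub_zero, zero_add, add_comm (fun j : Fin n => -(w j : ℤ))]
    have e : x * (t * (w i : K)) = t * ((w i : K) * x) := by ring
    rw [e, AddMonoidAlgebra.single_sub]
    abel
  have hstab : ∀ v ∈ Submodule.span K X, D v ∈ Submodule.span K X := by
    refine fun v hv => map_mem_span D _ hD ?_ hv
    rintro _ (⟨⟨i, m⟩, rfl⟩ | ⟨⟨k, hk⟩, rfl⟩)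
    · change D (relElt x t w i m) ∈ _
      rw [hDrel]
      exact Submodule.smul_mem _ _ (hrel _ _)
    · change D (omegaFn K w k) ∈ _
      have h : coeffDer (Fin n → ℤ) δ (omegaFn K w k) = 0 := by
        rw [omegaFn_eq, coeffDer_single, Derivation.map_algebraMap, AddMonoidAlgebra.single_zero]
      rw [hDapp, h, smul_zero, sub_zero]
      rcases Nat.eq_zero_or_pos k with rfl | h1
      · have : AddMonoidAlgebra.single (fun j => -(w j : ℤ)) x * omegaFn K w 0 =
            x • omegaFn K w 1 := by
          rw [omegaFn_zero, omegaFn_one, AddMonoidAlgebra.single_mul_single,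
            AddMonoidAlgebra.smul_single, add_zero, smul_eq_mul]
        rw [this]
        exact Submodule.smul_mem _ _ (homega 1 hk)
      · obtain ⟨c, i, m, h⟩ := single_mul_omegaFn x t hw h1 hk
        rw [h]
        exact add_mem (add_mem (homega _ hk) (Submodule.smul_mem _ _ (homega _ hk.le)))
          (Submodule.smul_mem _ _ (hrel _ _))
  have hdown : ∀ m : Fin n → ℤ, AddMonoidAlgebra.single m (1 : K) ∈ Submodule.span K X →
      AddMonoidAlgebra.single (m + fun j => -(w j : ℤ)) (1 : K) ∈ Submodule.span K X := by
    intro m hm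
    have h := Submodule.smul_mem _ y (hstab _ hm)
    rw [hDapp, coeffDer_single, Derivation.map_one_eq_zero, AddMonoidAlgebra.single_zero, smul_zero,
      sub_zero, AddMonoidAlgebra.single_mul_single, AddMonoidAlgebra.smul_single, mul_one,
      smul_eq_mul, mul_comm, hxy, add_comm] at h
    exact h
  have hup : ∀ (i : Fin n) (m : Fin n → ℤ), AddMonoidAlgebra.single m (1 : K) ∈ Submodule.span K X →
      AddMonoidAlgebra.single (m + Pi.single i 1) (1 : K) ∈ Submodule.span K X := by
    intro i m hm
    have e : AddMonoidAlgebra.single (m + Pi.single i 1) (1 : K) =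
        (t * (m i : K)) • AddMonoidAlgebra.single m (1 : K) +
        ((w i : K) * x) • AddMonoidAlgebra.single (m + fun j => -(w j : ℤ)) (1 : K) -
        relElt x t w i m := by
      rw [relElt]
      simp only [AddMonoidAlgebra.smul_single, smul_eq_mul, mul_one]
      abel
    rw [e]
    exact sub_mem (add_mem (Submodule.smul_mem _ _ hm) (Submodule.smul_mem _ _ (hdown m hm)))
      (hrel i m)
  have hnat : ∀ (s : ℕ) (m : Fin n → ℕ), ∑ i, m i = s →
      AddMonoidAlgebra.single (fun j => (m j : ℤ)) (1 : K) ∈ Submodule.span K X := by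
    intro s
    induction s with
    | zero =>
      intro m hm
      have : (fun j => (m j : ℤ)) = 0 := by
        funext i
        rw [(Finset.sum_eq_zero_iff.1 hm) i (Finset.mem_univ i)]
        rfl
      rw [this, ← omegaFn_zero w]
      exact homega 0 (Nat.zero_le _)
    | succ s ih =>
      intro m hm
      obtain ⟨i, -, hi⟩ : ∃ i ∈ Finset.univ, m i ≠ 0 :=
        Finset.exists_ne_zero_of_sum_ne_zero (by omega)
      obtain ⟨m', rfl⟩ : ∃ m', m = m' + Pi.single i 1 := by
        refine ⟨m - Pi.single i 1, (tsub_add_cancel_of_le ?_).symm⟩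
        intro j
        by_cases h : j = i
        · subst h; simpa using Nat.one_le_iff_ne_zero.2 hi
        · simp [h]
      have hm' : ∑ i, m' i = s := by
        simpa [Finset.sum_add_distrib] using hm
      have e : (fun j => (((m' + Pi.single i 1 : Fin n → ℕ) j : ℕ) : ℤ)) =
          (fun j => (m' j : ℤ)) + Pi.single i 1 := by
        funext j
        by_cases h : j = i
        · subst h; simp
        · simp [h]
      rw [e]
      exact hup i _ (ih m' hm')
  have hshift : ∀ (c : ℕ) (m : Fin n → ℕ),
      AddMonoidAlgebra.single (fun j => (m j : ℤ) - c * w j) (1 : K) ∈ Submodule.span K X := by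
    intro c m
    induction c with
    | zero => simpa using hnat _ m rfl
    | succ c ih =>
      have e : (fun j => (m j : ℤ) - (c + 1 : ℕ) * w j) =
          (fun j => (m j : ℤ) - c * w j) + fun j => -(w j : ℤ) := by
        funext j
        simp only [Pi.add_apply]
        push_cast
        ring
      rw [e]
      exact hdown _ ih
  -- Every `u^m` is a power of `u₀` times a monomial with nonnegative exponents.
  have hall : ∀ m : Fin n → ℤ, AddMonoidAlgebra.single m (1 : K) ∈ Submodule.span K X := by
    intro m
    have h := hshift (∑ i, (m i).natAbs) fun j => (m j + (∑ i, (m i).natAbs : ℕ) * w j).toNat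
    convert h using 2
    funext j
    have h1 : (m j).natAbs ≤ ∑ i, (m i).natAbs :=
      Finset.single_le_sum (f := fun i => (m i).natAbs) (fun _ _ => Nat.zero_le _)
        (Finset.mem_univ j)
    have h2 : (m j).natAbs ≤ (∑ i, (m i).natAbs) * w j := h1.trans (Nat.le_mul_of_pos_right _ (hw j))
    have h3 : ((m j).natAbs : ℤ) ≤ ((∑ i, (m i).natAbs : ℕ) : ℤ) * (w j : ℤ) := by exact_mod_cast h2
    rw [Int.toNat_of_nonneg (by omega)]
    ring
  refine eq_top_iff.2 fun g _ => ?_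
  induction g using AddMonoidAlgebra.induction_linear with
  | zero => exact zero_mem _
  | add f g hf hg => exact add_mem (hf trivial) (hg trivial)
  | single m r =>
    have := Submodule.smul_mem _ r (hall m)
    rwa [AddMonoidAlgebra.smul_single, smul_eq_mul, mul_one] at this

/-- The module on which the relations are realized has a basis `e_k` with the same recursion as the
`ω_k`. -/
theorem exists_linearMap_omegaFn (δ : Derivation ℂ K K) {x y t : K} (hxy : x * y = 1)
    (hδx : δ x = x) (hδt : δ t = 0) {n : ℕ} {w : Fin n → ℕ} (hw : ∀ i, 0 < w i) :
    ∃ Φ : Fn K n →ₗ[K] (Fin (mu w) → K), relSub x t w ≤ LinearMap.ker Φ ∧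
      ∀ k : Fin (mu w), Φ (omegaFn K w k) = Pi.single k 1 := by
  -- Beyond the basis range only the value at `k = μ` matters; it encodes the closing relation for
  -- `ω_μ`.
  let e : ℕ → (Fin (mu w) → K) := fun k => if h : k < mu w then Pi.single ⟨k, h⟩ 1 else
    algebraMap ℂ K (∏ i, (w i : ℂ) ^ w i)⁻¹ • Pi.single ⟨0, mu_pos w⟩ 1
  have he : ∀ k (h : k < mu w), e k = Pi.single ⟨k, h⟩ 1 := fun k h => dif_pos h
  let col : Fin (mu w) → (Fin (mu w) → K) := fun k => if k.val = 0 then x • e 1 else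
    e (k + 1) + (t * algebraMap ℂ K (1 - (minRatio w k : ℂ))) • e k
  let C : (Fin (mu w) → K) →ₗ[K] (Fin (mu w) → K) := Fintype.linearCombination K col
  let D : (Fin (mu w) → K) →+ (Fin (mu w) → K) := AddMonoidHom.mk'
    (fun v => C v - t • fun j => δ (v j)) (by
      intro u v
      rw [map_add]
      have : (fun j => δ ((u + v) j)) = (fun j => δ (u j)) + fun j => δ (v j) := by
        funext j; simp
      rw [this]
      module)
  have hDapp : ∀ v, D v = C v - t • fun j => δ (v j) := fun v => rfl
  have hDe : ∀ k (h : k < mu w), D (e k) = col ⟨k, h⟩ := by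
    intro k h
    have h0 : (fun j => δ (e k j)) = 0 := by
      funext j
      rw [he k h]
      by_cases hj : j = ⟨k, h⟩
      · subst hj; simp
      · simp [hj]
    rw [hDapp, h0, smul_zero, sub_zero, he k h]
    simp [C, Fintype.linearCombination_apply_single]
  obtain ⟨Φ, h1, h2⟩ := exists_realization δ hxy hδx hδt hw D (by
      intro f v
      have : (fun j => δ ((f • v) j)) = f • (fun j => δ (v j)) + δ f • v := by
        funext j; simp [mul_comm]
      rw [hDapp, hDapp, map_smul, this]
      module) e
    (by rw [hDe 0 (mu_pos w)]; simp [col])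
    (by
      intro k hk hk'
      rw [hDe k hk']
      simp only [col]
      rw [if_neg (by omega)])
    (by
      rw [he 0 (mu_pos w)]
      simp [e])
  refine ⟨Φ, ?_, fun k => ?_⟩
  · rw [relSub, Submodule.span_le]
    rintro _ ⟨p, rfl⟩
    exact h1 _ _
  · rw [h2 k k.2, he k k.2]

/-- If `π` presents `Q` as the quotient by the relations, the `ω_k` form a basis of `Q`. -/
theorem exists_basis_omegaFn (δ : Derivation ℂ K K) {x y t : K} (hxy : x * y = 1)
    (hδx : δ x = x) (hδt : δ t = 0) {n : ℕ} {w : Fin n → ℕ} (hw : ∀ i, 0 < w i)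
    {Q : Type} [AddCommGroup Q] [Module K Q] (π : Fn K n →ₗ[K] Q)
    (hπ : Function.Surjective π) (hker : LinearMap.ker π = relSub x t w) :
    ∃ b : Module.Basis (Fin (mu w)) K Q, ∀ k, b k = π (omegaFn K w k) := by
  obtain ⟨Φ, hΦ, hΦω⟩ := exists_linearMap_omegaFn δ hxy hδx hδt hw
  -- A dependence lies in the relations, so `Φ` turns it into a dependence between coordinate
  -- vectors.
  have hli : LinearIndependent K fun k : Fin (mu w) => π (omegaFn K w k) := by
    rw [Fintype.linearIndependent_iff]
    intro g hg k
    have h1 : ∑ k : Fin (mu w), g k • omegaFn K w k ∈ relSub x t w := by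
      rw [← hker, LinearMap.mem_ker, map_sum]
      simpa using hg
    have h2 := LinearMap.mem_ker.1 (hΦ h1)
    rw [map_sum] at h2
    simp only [map_smul, hΦω] at h2
    have h3 := congrFun h2 k
    simpa [Finset.sum_apply, Pi.single_apply] using h3
  refine ⟨Module.Basis.mk hli ?_, fun k => by rw [Module.Basis.mk_apply]⟩
  have h := congrArg (Submodule.map π) (span_relSub_omegaFn δ hxy hδx hδt hw)
  rw [Submodule.map_sup, ← hker, Submodule.map_span, ← Set.range_comp, Submodule.map_top,
    LinearMap.range_eq_top.2 hπ] at h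
  rw [← h]
  refine sup_le ?_ le_rfl
  rintro _ ⟨v, hv, rfl⟩
  rw [LinearMap.mem_ker.1 hv]
  exact zero_mem _

end Presentation

end

end Brieskorn

namespace Brieskorn

noncomputable section

/-! ### From differential forms to the relations between monomials -/

section Forms

variable {K : Type} [CommRing K] {n : ℕ}

/-- The isomorphism `g ↦ g · du₁/u₁ ∧ ⋯ ∧ duₙ/uₙ`, as a linear map. -/
def topFormLin (K : Type) [CommRing K] (n : ℕ) : Fn K n →ₗ[K] Form K n n :=
  LinearMap.pi fun _ => LinearMap.id

theorem topFormLin_apply (g : Fn K n) : topFormLin K n g = topForm g := rfl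

theorem eq_univ (S : {S : Finset (Fin n) // S.card = n}) : S = ⟨Finset.univ, by simp⟩ := by
  refine Subtype.ext ((Finset.card_eq_iff_eq_univ _).1 ?_)
  rw [S.2, Fintype.card_fin]

theorem form_eq_topForm (η : Form K n n) : η = topForm (η ⟨Finset.univ, by simp⟩) := by
  funext S
  rw [eq_univ S]
  rfl

theorem topFormLin_surjective : Function.Surjective (topFormLin K n) := fun η =>
  ⟨_, (form_eq_topForm η).symm⟩

theorem topFormLin_injective : Function.Injective (topFormLin K n) := fun _ _ h =>
  congrFun h ⟨Finset.univ, by simp⟩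

theorem range_frameWedge (T : Fin n → Fn K n →ₗ[K] Fn K n) :
    LinearMap.range (frameWedge n T) = (⨆ i, LinearMap.range (T i)).map (topFormLin K n) := by
  apply le_antisymm
  · rintro _ ⟨η, rfl⟩
    refine ⟨frameWedge n T η ⟨Finset.univ, by simp⟩, ?_,
      (form_eq_topForm (frameWedge n T η)).symm⟩
    simp only [frameWedge, LinearMap.pi_apply, LinearMap.sum_apply, LinearMap.smul_apply]
    refine sum_mem fun i _ => Submodule.smul_mem _ _ (Submodule.mem_iSup_of_mem i.1 ?_)
    exact ⟨_, rfl⟩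
  · rw [Submodule.map_iSup]
    refine iSup_le fun i => ?_
    rintro _ ⟨_, ⟨g, rfl⟩, rfl⟩
    have hcard : ∀ j : Fin n, (Finset.univ.erase j).card = n - 1 := fun j => by
      rw [Finset.card_erase_of_mem (Finset.mem_univ j)]; simp
    -- A form supported on the frame omitting `duᵢ/uᵢ` meets only `Tᵢ`; the sign is inserted so that
    -- it squares away.
    refine ⟨Pi.single ⟨Finset.univ.erase i, hcard i⟩
      ((-1 : K) ^ (Finset.univ.filter fun j => j < i).card • g), ?_⟩
    rw [form_eq_topForm (frameWedge n T _), topFormLin_apply]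
    congr 1
    simp only [frameWedge, LinearMap.pi_apply, LinearMap.sum_apply, LinearMap.smul_apply,
      LinearMap.comp_apply, LinearMap.proj_apply]
    rw [Finset.sum_eq_single ⟨i, Finset.mem_univ i⟩]
    · rw [Pi.single_eq_same, map_smul, smul_smul, ← mul_pow]
      simp
    · intro j _ hj
      rw [Pi.single_eq_of_ne, map_zero, smul_zero]
      intro h
      refine hj (Subtype.ext ?_)
      have h1 : Finset.univ.erase j.1 = Finset.univ.erase i := congrArg Subtype.val h
      by_contra hne
      have h2 : j.1 ∈ Finset.univ.erase i := Finset.mem_erase.2 ⟨hne, Finset.mem_univ _⟩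
      rw [← h1] at h2
      exact Finset.notMem_erase _ _ h2
    · intro h
      exact absurd (Finset.mem_univ _) h

theorem dLog_single (i : Fin n) (m : Fin n → ℤ) (r : K) :
    dLog K i (AddMonoidAlgebra.single m r) = AddMonoidAlgebra.single m ((m i : K) * r) := by
  rw [dLog, eulerDer_single]
  rfl

theorem ker_mkQ_comp_topFormLin {M : Submodule K (Form K n n)} {P : Submodule K (Fn K n)}
    (h : M = P.map (topFormLin K n)) : LinearMap.ker (M.mkQ ∘ₗ topFormLin K n) = P := by
  rw [LinearMap.ker_comp, Submodule.ker_mkQ, h,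
    Submodule.comap_map_eq_of_injective topFormLin_injective]

variable [Algebra Lx K]

/-- The parameter `x` in the coefficient ring. -/
abbrev xElt (K : Type) [CommRing K] [Algebra Lx K] : K :=
  algebraMap Lx K (LaurentPolynomial.T 1)

theorem dLog_potential (w : Fin n → ℕ) (i : Fin n) :
    dLog K i (potential K w) = AddMonoidAlgebra.single (Pi.single i (1 : ℤ)) 1 -
      AddMonoidAlgebra.single (fun j => -(w j : ℤ)) ((w i : K) * xElt K) := by
  rw [potential, map_add, map_sum, dLog_single, Finset.sum_eq_single i]
  · rw [dLog_single, sub_eq_add_neg, ← AddMonoidAlgebra.single_neg]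
    simp
  · intro j _ hj
    rw [dLog_single, Pi.single_eq_of_ne hj.symm]
    simp
  · intro h
    exact absurd (Finset.mem_univ _) h

theorem iSup_range_eq_relSub (t : K) (w : Fin n → ℕ) :
    ⨆ i, LinearMap.range (t • (dLog K i : Fn K n →ₗ[K] Fn K n) -
      LinearMap.mulLeft K (dLog K i (potential K w))) = relSub (xElt K) t w := by
  have key : ∀ i m, (t • (dLog K i : Fn K n →ₗ[K] Fn K n) -
      LinearMap.mulLeft K (dLog K i (potential K w))) (AddMonoidAlgebra.single m 1) =
      relElt (xElt K) t w i m := by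
    intro i m
    rw [LinearMap.sub_apply, LinearMap.smul_apply, LinearMap.mulLeft_apply, Derivation.coeFn_coe,
      dLog_single, dLog_potential, sub_mul, AddMonoidAlgebra.single_mul_single,
      AddMonoidAlgebra.single_mul_single, AddMonoidAlgebra.smul_single, relElt, add_comm _ m,
      add_comm _ m]
    simp only [mul_one, smul_eq_mul]
    abel
  apply le_antisymm
  · refine iSup_le fun i => ?_
    rintro _ ⟨g, rfl⟩
    induction g using AddMonoidAlgebra.induction_linear with
    | zero => rw [map_zero]; exact zero_mem _
    | add f g hf hg => rw [map_add]; exact add_mem hf hg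
    | single m r =>
      have h := Submodule.smul_mem _ r (relElt_mem (xElt K) t w i m)
      rwa [← key, ← map_smul, AddMonoidAlgebra.smul_single, smul_eq_mul, mul_one] at h
  · rw [relSub, Submodule.span_le]
    rintro _ ⟨⟨i, m⟩, rfl⟩
    exact Submodule.mem_iSup_of_mem i ⟨_, key i m⟩

theorem range_twisted_differential (t : K) (w : Fin n → ℕ) :
    LinearMap.range (t • extD K n n - dWedge n (potential K w)) =
      (relSub (xElt K) t w).map (topFormLin K n) := by
  rw [← iSup_range_eq_relSub, ← range_frameWedge]
  congr 1
  refine LinearMap.ext fun η => funext fun S => ?_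
  simp only [extD, dWedge, frameWedge, LinearMap.sub_apply, LinearMap.smul_apply, Pi.sub_apply,
    Pi.smul_apply, LinearMap.pi_apply, LinearMap.sum_apply, LinearMap.comp_apply,
    LinearMap.proj_apply, Finset.smul_sum, smul_sub, Finset.sum_sub_distrib]
  congr 1
  refine Finset.sum_congr rfl fun i _ => ?_
  rw [smul_comm]

theorem latticeRel_eq (w : Fin n → ℕ) : latticeRel w =
    (relSub (xElt LxTheta) Polynomial.X w).map (topFormLin LxTheta n) :=
  range_twisted_differential _ w

/-- `d_u - τ d_uF` is the unit `τ` times `θ d_u - d_uF`, so the ranges agree and the presentation of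
`G₀` carries over with `t = τ⁻¹`. -/
theorem systemRel_eq (w : Fin n → ℕ) : systemRel w =
    (relSub (xElt LxTau) (LaurentPolynomial.T (-1)) w).map (topFormLin LxTau n) := by
  rw [← range_twisted_differential, systemRel]
  have h1 : (LaurentPolynomial.T 1 : LxTau) * LaurentPolynomial.T (-1) = 1 := by
    rw [← LaurentPolynomial.T_add]; simp
  have e : extD LxTau n n - (LaurentPolynomial.T 1 : LxTau) • dWedge n (potential LxTau w) =
      (LaurentPolynomial.T 1 : LxTau) • ((LaurentPolynomial.T (-1) : LxTau) • extD LxTau n n -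
        dWedge n (potential LxTau w)) := by
    rw [smul_sub, smul_smul, h1, one_smul]
  rw [e]
  set L := (LaurentPolynomial.T (-1) : LxTau) • extD LxTau n n - dWedge n (potential LxTau w)
  apply le_antisymm
  · rintro _ ⟨η, rfl⟩
    exact ⟨(LaurentPolynomial.T 1 : LxTau) • η, by rw [map_smul, LinearMap.smul_apply]⟩
  · rintro _ ⟨η, rfl⟩
    refine ⟨(LaurentPolynomial.T (-1) : LxTau) • η, ?_⟩
    rw [map_smul, LinearMap.smul_apply, smul_smul, mul_comm, h1, one_smul]

theorem formMap_omegaForm (w : Fin n → ℕ) (k : ℕ) :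
    formMap n n (omegaForm LxTheta w k) = omegaForm LxTau w k := by
  funext S
  change fnMap n (AddMonoidAlgebra.single _ _) = AddMonoidAlgebra.single _ _
  rw [fnMap_single]
  congr 1
  change thetaIncl (Polynomial.C _) = _
  simp only [thetaIncl, Polynomial.coe_eval₂RingHom, Polynomial.eval₂_C]
  rfl

theorem toG_omega (w : Fin n → ℕ) (k : ℕ) :
    toG w (omega w k) = (systemRel w).mkQ (omegaForm LxTau w k) := by
  rw [← formMap_omegaForm]
  rfl

theorem laurentDeriv_T (k : ℤ) :
    laurentDeriv ℂ (LaurentPolynomial.T k) = (k : ℂ) • LaurentPolynomial.T (k - 1) := by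
  change (LaurentPolynomial.T (-1) : Lx) * eulerDer ℂ (AddMonoidHom.id ℤ) _ = _
  rw [LaurentPolynomial.T, LaurentPolynomial.T, eulerDer_single,
    AddMonoidAlgebra.single_mul_single, LaurentPolynomial.T, AddMonoidAlgebra.smul_single]
  congr 1
  · ring
  · simp

theorem dX_C (a : Lx) : dX (LaurentPolynomial.C a) = LaurentPolynomial.C (laurentDeriv ℂ a) := by
  rw [← LaurentPolynomial.single_eq_C, dX, coeffDer_single, LaurentPolynomial.single_eq_C]

theorem xElt_tau : xElt LxTau = LaurentPolynomial.C (LaurentPolynomial.T 1) := rfl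

theorem dX_xElt : dX (xElt LxTau) = 1 := by
  rw [xElt_tau, dX_C, laurentDeriv_T]
  simp

theorem xElt_mul_inv (K : Type) [CommRing K] [Algebra Lx K] :
    xElt K * algebraMap Lx K (LaurentPolynomial.T (-1)) = 1 := by
  rw [← map_mul, ← LaurentPolynomial.T_add]
  simp

/-- `x ∂/∂x` on `ℂ[x, x⁻¹, τ, τ⁻¹]`. -/
def xdxTau : Derivation ℂ LxTau LxTau := xElt LxTau • dX

theorem xdxTau_xElt : xdxTau (xElt LxTau) = xElt LxTau := by
  rw [xdxTau, Derivation.smul_apply, dX_xElt, smul_eq_mul, mul_one]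

theorem xdxTau_T (k : ℤ) : xdxTau (LaurentPolynomial.T k) = 0 := by
  rw [xdxTau, Derivation.smul_apply, dX_T, smul_zero]

/-- `x ∂/∂x` on `ℂ[x, x⁻¹, θ]`. -/
def xdxTheta : Derivation ℂ LxTheta LxTheta :=
  xElt LxTheta •
    (PolynomialModule.equivPolynomialSelf (R := Lx)).toLinearMap.compDer (laurentDeriv ℂ).mapCoeffs

theorem xdxTheta_monomial (k : ℕ) (a : Lx) : xdxTheta (Polynomial.monomial k a) =
    xElt LxTheta * Polynomial.monomial k (laurentDeriv ℂ a) := by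
  change xElt LxTheta * PolynomialModule.equivPolynomialSelf
    ((laurentDeriv ℂ).mapCoeffs (Polynomial.monomial k a)) = _
  rw [Derivation.mapCoeffs_monomial]
  congr 1

theorem xdxTheta_xElt : xdxTheta (xElt LxTheta) = xElt LxTheta := by
  change xdxTheta (Polynomial.monomial 0 _) = _
  rw [xdxTheta_monomial, Algebra.algebraMap_self_apply, laurentDeriv_T]
  simp

theorem xdxTheta_X : xdxTheta Polynomial.X = 0 := by
  rw [← Polynomial.monomial_one_one_eq_X, xdxTheta_monomial, Derivation.map_one_eq_zero, map_zero,
    mul_zero]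

end Forms

end

end Brieskorn

namespace Brieskorn

noncomputable section

/-! ### The matrices of the connection -/

section Connection

/-- Multiplication by `F` on a monomial, modulo the relations. -/
theorem potential_mul_single {K : Type} [CommRing K] [Algebra Lx K] (t : K) {n : ℕ}
    (w : Fin n → ℕ) (m : Fin n → ℤ) (r : K) :
    potential K w * AddMonoidAlgebra.single m r = (t * ((∑ i, m i : ℤ) : K)) •
      AddMonoidAlgebra.single m r + (mu w : K) •
      (AddMonoidAlgebra.single (fun j => -(w j : ℤ)) (xElt K) * AddMonoidAlgebra.single m r) -
      ∑ i, r • relElt (xElt K) t w i m := by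
  have h : ∑ i, r • relElt (xElt K) t w i m =
      (t * ((∑ i, m i : ℤ) : K)) • AddMonoidAlgebra.single m r -
      ∑ i, AddMonoidAlgebra.single (m + Pi.single i 1) r +
      (∑ i, (w i : K)) • AddMonoidAlgebra.single (m + fun j => -(w j : ℤ)) (xElt K * r) := by
    rw [Int.cast_sum, Finset.mul_sum, Finset.sum_smul, Finset.sum_smul, ← Finset.sum_sub_distrib,
      ← Finset.sum_add_distrib]
    refine Finset.sum_congr rfl fun i _ => ?_
    simp only [relElt, smul_add, smul_sub, AddMonoidAlgebra.smul_single, smul_eq_mul, mul_one]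
    rw [mul_left_comm r (w i : K) (xElt K), mul_comm r (xElt K), mul_comm r (t * (m i : K))]
  rw [h, potential, add_mul, Finset.sum_mul, mu]
  simp only [AddMonoidAlgebra.single_mul_single, one_mul, add_comm _ m, Nat.cast_add, Nat.cast_one,
    Nat.cast_sum]
  rw [add_smul, one_smul]
  abel

variable {n : ℕ} {w : Fin n → ℕ}

/-- The class in `G` of `g · du₁/u₁ ∧ ⋯ ∧ duₙ/uₙ`. -/
def toSystem (w : Fin n → ℕ) : Fn LxTau n →ₗ[LxTau] G w :=
  (systemRel w).mkQ ∘ₗ topFormLin LxTau n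

theorem ker_toSystem (w : Fin n → ℕ) : LinearMap.ker (toSystem w) =
    relSub (xElt LxTau) (LaurentPolynomial.T (-1)) w :=
  ker_mkQ_comp_topFormLin (systemRel_eq w)

theorem toSystem_relElt (i : Fin n) (m : Fin n → ℤ) :
    toSystem w (relElt (xElt LxTau) (LaurentPolynomial.T (-1)) w i m) = 0 := by
  rw [← LinearMap.mem_ker, ker_toSystem]
  exact relElt_mem _ _ _ _ _

/-- The diagonal entries of `-R`. -/
def residue (w : Fin n → ℕ) (k : ℕ) : ℚ := if k = 0 then 0 else 1 - minRatio w k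

/-- The off-diagonal part of the action of `x u₀` on `ω_k`. -/
def shiftClass (w : Fin n → ℕ) (k : ℕ) : G w :=
  (if k = 0 then xElt LxTau else 1) • toSystem w (omegaFn LxTau w (k + 1))

theorem toSystem_single_mul (hw : ∀ i, 0 < w i) {k : ℕ} (hk : k < mu w) :
    toSystem w (AddMonoidAlgebra.single (fun j => -(w j : ℤ)) (xElt LxTau) * omegaFn LxTau w k) =
      shiftClass w k + ((LaurentPolynomial.T (-1) : LxTau) *
        algebraMap ℂ LxTau (residue w k : ℂ)) • toSystem w (omegaFn LxTau w k) := by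
  rcases Nat.eq_zero_or_pos k with rfl | h1
  · have : AddMonoidAlgebra.single (fun j => -(w j : ℤ)) (xElt LxTau) * omegaFn LxTau w 0 =
        xElt LxTau • omegaFn LxTau w 1 := by
      rw [omegaFn_zero, omegaFn_one, AddMonoidAlgebra.single_mul_single,
        AddMonoidAlgebra.smul_single, add_zero, smul_eq_mul]
    rw [this, map_smul]
    simp [shiftClass, residue]
  · obtain ⟨c, i, m, h⟩ := single_mul_omegaFn (xElt LxTau) (LaurentPolynomial.T (-1)) hw h1 hk
    rw [h, map_add, map_add, map_smul, map_smul, toSystem_relElt, smul_zero, add_zero, shiftClass,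
      residue, if_neg h1.ne', if_neg h1.ne', one_smul]
    push_cast
    rfl

theorem s_eq_residue (hw : ∀ i, 0 < w i) {k : ℕ} (h1 : 1 ≤ k) (hk : k < mu w) :
    s w k = mu w - mu w * residue w k := by
  rw [s_eq w hw hk, residue, if_neg (by omega)]
  ring

/-- For `k ≥ 1` the exponents of `ω_k` sum to `(k - 1) - (μ - 1) = k - μ`, and the residue term
contributes `μ - s_k`. -/
theorem alpha_eq (hw : ∀ i, 0 < w i) {k : ℕ} (hk : k < mu w) :
    alpha w k = ((∑ i : Fin n, ((multiIndex w k i.succ : ℤ) - (multiIndex w k 0 : ℤ) * (w i : ℤ)) :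
      ℤ) : ℚ) + mu w * residue w k := by
  have hsum : (multiIndex w k 0 : ℚ) + ∑ i : Fin n, (multiIndex w k i.succ : ℚ) = k := by
    have := sum_multiIndex w k
    rw [Fin.sum_univ_succ] at this
    exact_mod_cast this
  have hmu : (mu w : ℚ) = 1 + ∑ i, (w i : ℚ) := by simp [mu]
  rw [alpha]
  push_cast
  rw [Finset.sum_sub_distrib, ← Finset.mul_sum]
  rcases Nat.eq_zero_or_pos k with rfl | h1
  · rw [s_eq_zero w hw (Nat.zero_le _)]
    simp [multiIndex, residue]
  · rw [s_eq_residue hw h1 hk]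
    rw [multiIndex_zero_eq_one w hw h1 hk.le] at hsum ⊢
    push_cast at hsum ⊢
    linarith

/-- For `1 ≤ k ≤ n` one has `s_k = 0`, which gives `-1`; for larger `k` the reflection replaces
`s_{μ+n-k}` by `μ - s_k`. -/
theorem R_apply_self (hw : ∀ i, 0 < w i) (k : Fin (mu w)) :
    R w k k = ((-residue w k : ℚ) : ℂ) := by
  rw [R, Matrix.diagonal_apply_eq]
  have hmu : (mu w : ℚ) ≠ 0 := by exact_mod_cast (mu_pos w).ne'
  split_ifs with h0 hn
  · simp [residue, h0]
  · have h := s_eq_residue hw (by omega) k.2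
    rw [s_eq_zero w hw hn] at h
    have h2 : residue w k = 1 := by
      have : (mu w : ℚ) * residue w k = mu w * 1 := by linarith
      exact mul_left_cancel₀ hmu this
    rw [h2]; simp
  · congr 1
    rw [s_reflect w hw (by omega) k.2, s_eq_residue hw (by omega) k.2]
    field_simp
    ring

theorem sum_A0 (hn : 0 < n) (hw : ∀ i, 0 < w i) (B : Fin (mu w) → G w)
    (hB : ∀ k, B k = toSystem w (omegaFn LxTau w k)) (k : Fin (mu w)) :
    ∑ j, algebraMap Lx LxTau (A0 w j k) • B j = (mu w : LxTau) • shiftClass w k := by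
  have hmu := lt_mu w hw
  obtain ⟨k, hk⟩ := k
  have hcast : ∀ c : ℂ, algebraMap Lx LxTau (algebraMap ℂ Lx c) = algebraMap ℂ LxTau c :=
    fun c => (IsScalarTower.algebraMap_apply ℂ Lx LxTau c).symm
  rcases (Nat.succ_le_of_lt hk).lt_or_eq with h | h
  · rw [Finset.sum_eq_single ⟨k + 1, h⟩]
    · rw [A0, Matrix.of_apply, if_pos rfl, shiftClass, hB, smul_smul]
      congr 1
      split_ifs
      · rw [map_mul, hcast, map_natCast]
      · rw [hcast, map_natCast, mul_one]
    · intro j _ hj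
      rw [A0, Matrix.of_apply, if_neg (fun hh => hj (Fin.ext hh.symm)),
        if_neg (by rintro ⟨-, h2⟩; simp only at h2; omega), map_zero, zero_smul]
    · intro hh
      exact absurd (Finset.mem_univ _) hh
  · have h' : k + 1 = mu w := h
    rw [Finset.sum_eq_single ⟨0, mu_pos w⟩]
    -- As `n ≥ 1` gives `μ ≥ 2`, the last column is not column `0`, so the factor `x` is absent.
    · rw [A0, Matrix.of_apply, if_neg (by simp), if_pos ⟨rfl, h'⟩, shiftClass, hB, if_neg (by
        simp only; omega), one_smul]
      simp only
      rw [h', omegaFn_mu w hw, map_smul, smul_smul, hcast, div_eq_mul_inv, map_mul, map_natCast]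
    · intro j _ hj
      rw [A0, Matrix.of_apply, if_neg (by simp only; omega),
        if_neg (fun hh => hj (Fin.ext hh.1)), map_zero, zero_smul]
    · intro hh
      exact absurd (Finset.mem_univ _) hh

theorem T_mul_T_neg : (LaurentPolynomial.T 1 : LxTau) * LaurentPolynomial.T (-1) = 1 := by
  rw [← LaurentPolynomial.T_add]; simp

theorem coeffDer_omegaFn {K : Type} [CommRing K] [Algebra ℂ K] (δ : Derivation ℂ K K) (k : ℕ) :
    coeffDer (Fin n → ℤ) δ (omegaFn K w k) = 0 := by
  rw [omegaFn, coeffDer_single, Derivation.map_algebraMap, AddMonoidAlgebra.single_zero]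

theorem connOp_omegaForm (δ : Derivation ℂ LxTau LxTau) (f : Fn LxTau n) (k : ℕ) :
    (systemRel w).mkQ (connOp n δ f (omegaForm LxTau w k)) =
      -toSystem w (f * omegaFn LxTau w k) := by
  rw [← map_neg]
  change _ = (systemRel w).mkQ (topForm _)
  congr 1
  funext S
  rw [connOp_apply]
  change coeffDer (Fin n → ℤ) δ (omegaFn LxTau w k) - f * omegaFn LxTau w k = _
  rw [coeffDer_omegaFn, zero_sub]
  rfl

theorem nablaTheta_omega (hn : 0 < n) (hw : ∀ i, 0 < w i) (B : Fin (mu w) → G w)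
    (hB : ∀ k, B k = toSystem w (omegaFn LxTau w k)) (k : Fin (mu w)) :
    nablaTheta w (B k) = ∑ j, connTheta w j k • B j := by
  have hL : nablaTau w (B k) = -toSystem w (potential LxTau w * omegaFn LxTau w k) := by
    rw [hB, ← connOp_omegaForm dTau]
    rfl
  -- Summing the relations over `i` replaces `F` by `μ x u₀` plus `θ` times the degree in `u`; the
  -- diagonal part is then `θ α_k`.
  have hF : toSystem w (potential LxTau w * omegaFn LxTau w k) =
      (mu w : LxTau) • shiftClass w k +
        ((LaurentPolynomial.T (-1) : LxTau) * algebraMap ℂ LxTau (alpha w k : ℂ)) • B k := by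
    rw [omegaFn, potential_mul_single (LaurentPolynomial.T (-1))]
    rw [map_sub, map_add, map_smul, map_smul, map_sum]
    simp only [map_smul, toSystem_relElt, smul_zero, Finset.sum_const_zero, sub_zero]
    rw [← omegaFn, toSystem_single_mul hw k.2, ← hB, alpha_eq hw k.2]
    rw [Rat.cast_add, Rat.cast_mul, Rat.cast_intCast, Rat.cast_natCast, map_add, map_mul,
      map_intCast, map_natCast]
    module
  have hR : ∑ j, connTheta w j k • B j = (LaurentPolynomial.T 1 : LxTau) •
      ((LaurentPolynomial.T 1 : LxTau) • ((mu w : LxTau) • shiftClass w k) +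
        algebraMap ℂ LxTau (alpha w k : ℂ) • B k) := by
    rw [← sum_A0 hn hw B hB]
    simp only [connTheta, Matrix.smul_apply, Matrix.add_apply, Matrix.map_apply, smul_eq_mul,
      mul_smul, add_smul, ← Finset.smul_sum, Finset.sum_add_distrib]
    congr 2
    rw [Finset.sum_eq_single k]
    · rw [AInf, Matrix.diagonal_apply_eq]
    · intro j _ hj
      rw [AInf, Matrix.diagonal_apply_ne _ hj, map_zero, zero_smul]
    · intro hh
      exact absurd (Finset.mem_univ _) hh
  have hT : (LaurentPolynomial.T 2 : LxTau) = LaurentPolynomial.T 1 * LaurentPolynomial.T 1 := by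
    rw [← LaurentPolynomial.T_add]; norm_num
  rw [nablaTheta, hL, smul_neg, neg_neg, hF, hR, hT, mul_smul, smul_add (LaurentPolynomial.T 1),
    smul_smul _ (_ * _), ← mul_assoc, T_mul_T_neg, one_mul]

theorem coeffDer_dX_potential : coeffDer (Fin n → ℤ) dX (potential LxTau w) =
    AddMonoidAlgebra.single (fun j => -(w j : ℤ)) 1 := by
  have h : dX (algebraMap Lx LxTau (LaurentPolynomial.T 1)) = 1 := dX_xElt
  simp only [potential, map_add, map_sum, coeffDer_single, h, Derivation.map_one_eq_zero,
    AddMonoidAlgebra.single_zero, Finset.sum_const_zero, zero_add]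

theorem nablaX_omega (hn : 0 < n) (hw : ∀ i, 0 < w i) (B : Fin (mu w) → G w)
    (hB : ∀ k, B k = toSystem w (omegaFn LxTau w k)) (k : Fin (mu w)) :
    nablaX w (B k) = ∑ j, connX w j k • B j := by
  set y : LxTau := algebraMap Lx LxTau (LaurentPolynomial.T (-1)) with hy
  have hL : nablaX w (B k) = -toSystem w (((LaurentPolynomial.T 1 : LxTau) •
      coeffDer (Fin n → ℤ) dX (potential LxTau w)) * omegaFn LxTau w k) := by
    rw [hB, ← connOp_omegaForm dX]
    rfl
  -- `∂F/∂x = u₀` is rewritten as `x⁻¹ · x u₀`, so that the recursion for `x u₀` applies.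
  have hu : (AddMonoidAlgebra.single (fun j => -(w j : ℤ)) 1 : Fn LxTau n) =
      y • AddMonoidAlgebra.single (fun j => -(w j : ℤ)) (xElt LxTau) := by
    rw [AddMonoidAlgebra.smul_single, smul_eq_mul, mul_comm, xElt_mul_inv]
  have hR : ∑ j, connX w j k • B j = y • (algebraMap ℂ LxTau ((-residue w k : ℚ) : ℂ) • B k -
      (LaurentPolynomial.T 1 : LxTau) • shiftClass w k) := by
    have hmu : algebraMap ℂ LxTau (mu w : ℂ)⁻¹ * (mu w : LxTau) = 1 := by
      rw [← map_natCast (algebraMap ℂ LxTau), ← map_mul, inv_mul_cancel₀, map_one]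
      exact_mod_cast (mu_pos w).ne'
    have h2 : (LaurentPolynomial.T 1 : LxTau) • shiftClass w k =
        (algebraMap ℂ LxTau (mu w : ℂ)⁻¹ * LaurentPolynomial.T 1) •
          ∑ j, algebraMap Lx LxTau (A0 w j k) • B j := by
      rw [sum_A0 hn hw B hB, smul_smul, mul_right_comm, hmu, one_mul]
    rw [h2, ← R_apply_self hw]
    simp only [connX, Matrix.smul_apply, Matrix.sub_apply, Matrix.map_apply, smul_eq_mul,
      mul_smul, sub_smul, ← Finset.smul_sum, Finset.sum_sub_distrib]
    congr 2
    rw [Finset.sum_eq_single k]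
    · intro j _ hj
      rw [R, Matrix.diagonal_apply_ne _ hj, map_zero, zero_smul]
    · intro hh
      exact absurd (Finset.mem_univ _) hh
  rw [hL, hR, coeffDer_dX_potential, hu, smul_mul_assoc, smul_mul_assoc, map_smul, map_smul,
    toSystem_single_mul hw k.2, ← hB, Rat.cast_neg, map_neg]
  have h3 : (LaurentPolynomial.T 1 : LxTau) • y • ((LaurentPolynomial.T (-1) : LxTau) *
      algebraMap ℂ LxTau (residue w k : ℂ)) • B k =
      y • algebraMap ℂ LxTau (residue w k : ℂ) • B k := by
    rw [smul_comm, smul_smul _ (_ * _), ← mul_assoc, T_mul_T_neg, one_mul]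
  rw [smul_add, smul_add, h3]
  module

end Connection

end

end Brieskorn

theorem proposition3p2 (n : ℕ) (hn : 0 < n) (w : Fin n → ℕ) (hw : ∀ i, 0 < w i) :
    Module.Free Brieskorn.LxTheta (Brieskorn.G0 w) ∧
    Module.finrank Brieskorn.LxTheta (Brieskorn.G0 w) = Brieskorn.mu w ∧
    -- the family `ω` is a basis of the lattice `G₀`, and its image is a basis of `G`
    ∃ (b : Module.Basis (Fin (Brieskorn.mu w)) Brieskorn.LxTheta (Brieskorn.G0 w))
      (B : Module.Basis (Fin (Brieskorn.mu w)) Brieskorn.LxTau (Brieskorn.G w)),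
      (∀ k, b k = Brieskorn.omega w k) ∧
      (∀ k, B k = Brieskorn.toG w (Brieskorn.omega w k)) ∧
      -- the matrix of the connection in the basis `ω`
      (∀ k, Brieskorn.nablaTheta w (B k) = ∑ j, Brieskorn.connTheta w j k • B j) ∧
      (∀ k, Brieskorn.nablaX w (B k) = ∑ j, Brieskorn.connX w j k • B j) := by
  obtain ⟨b, hb⟩ := Brieskorn.exists_basis_omegaFn Brieskorn.xdxTheta
    (Brieskorn.xElt_mul_inv Brieskorn.LxTheta) Brieskorn.xdxTheta_xElt Brieskorn.xdxTheta_X hw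
    ((Brieskorn.latticeRel w).mkQ ∘ₗ Brieskorn.topFormLin Brieskorn.LxTheta n)
    ((Submodule.mkQ_surjective _).comp Brieskorn.topFormLin_surjective)
    (Brieskorn.ker_mkQ_comp_topFormLin (Brieskorn.latticeRel_eq w))
  -- The same basis statement, now with `θ` realized as `τ⁻¹`.
  obtain ⟨B, hB⟩ := Brieskorn.exists_basis_omegaFn Brieskorn.xdxTau
    (Brieskorn.xElt_mul_inv Brieskorn.LxTau) Brieskorn.xdxTau_xElt (Brieskorn.xdxTau_T (-1)) hw
    (Brieskorn.toSystem w)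
    ((Submodule.mkQ_surjective _).comp Brieskorn.topFormLin_surjective)
    (Brieskorn.ker_toSystem w)
  refine ⟨Module.Free.of_basis b, by rw [Module.finrank_eq_card_basis b, Fintype.card_fin], b, B,
    fun k => hb k, fun k => ?_, Brieskorn.nablaTheta_omega hn hw B hB,
    Brieskorn.nablaX_omega hn hw B hB⟩
  rw [hB, Brieskorn.toG_omega]
  rfl
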